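/- Let $k$ be a field, let $S$ be a commutative semigroup, and let $A = kS$ be its semigroup algebra (the $k$-vector space with basis $S$ and multiplication extended bilinearly from $S$; if $S$ has a zero element $z$, the statement holds both for this algebra and for the quotient $kS/kz$, in which the zero of $S$ is identified with $0$). Let $C^n(A,A)$ be the space of Hochschild $n$-cochains, i.e. of $k$-multilinear maps $A^n\to A$, with coboundary $$\delta f(a_1,\dots,a_{n+1}) = a_1f(a_2,\dots,a_{n+1})+\sum_{i=1}^n(-1)^if(\dots,a_ia_{i+1},\dots)+(-1)^{n+1}f(a_1,\dots,a_n)a_{n+1}.$$ For $n>0$ let $CC^n(A,A)\subseteq C^n(A,A)$ be the space of coherent cochains, i.e. of those $f$ for which $f(a_1,\dots,a_n)$ is a scalar multiple of $a_1a_2\cdots a_n$ for all $a_1,\dots,a_n\in S$, and let $CC^0(A,A)=0$. This is a subcomplex $CC^*(A,A)$ of $C^*(A,A)$; its cohomology is the coherent cohomology $CH^*(A,A)$. Let $e_n^{(i)}\in\mathbb{Q}[S_n]$, $1\le i\le n$, be the Gerstenhaber–Schack (Eulerian) idempotents, given by $$\sum_{i=1}^n e_n^{(i)}X^i=\sum_{\sigma\in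 S_n}\operatorname{sgn}(\sigma)\binom{X-1-\operatorname{des}(\sigma)+n}{n}\,\sigma ,$$ where $\operatorname{des}(\sigma)$ is the number of descents of $\sigma$; put $e_n^{(i)}=0$ for $i>n$. Let $\sigma\in S_n$ act on $n$-cochains by $(\sigma f)(a_1,\dots,a_n)=f(a_{\sigma^{-1}(1)},\dots,a_{\sigma^{-1}(n)})$. (a) If $\operatorname{char}k=0$, then the $e_n^{(i)}$, $i\ge1$, map $CC^n(A,A)$ to itself, act on it as pairwise orthogonal idempotents, and commute with $\delta$ (that is, $\delta e_n^{(i)}=e_{n+1}^{(i)}\delta$ on $CC^n(A,A)$). The subspaces $e_n^{(i)}CC^n(A,A)$ form, for each $i\ge 1$, a subcomplex $CC^{(i)}$, which vanishes in degrees $n<i$, and $CC^*(A,A)=\bigoplus_{i\ge1}CC^{(i)}$. (b) If $\operatorname{char}k=p>0$, then for $1\le i\le p-1$ the coefficients of $\bar e_n^{(i)}=\sum_{1\le j\le n,\ j\equiv i\ (\mathrm{mod}\ p-1)}e_n^{(j)}$ have denominators prime to $p$, so that $\bar e_n^{(i)}$ defines an element of $k[S_n]$. These elements map $CC^n(A,A)$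 to itself, act on it as pairwise orthogonal idempotents, and commute with $\delta$. The subspaces $\bar e_n^{(i)}CC^n(A,A)$ form subcomplexes $CC^{(i)}$, and $CC^*(A,A)=\bigoplus_{i=1}^{p-1}CC^{(i)}$. (c) In both cases the decomposition descends to cohomology: for every $n$ the inclusions induce an isomorphism $\bigoplus_i H^n(CC^{(i)})\to CH^n(A,A)$. -/

import Mathlib

noncomputable section

namespace CoherentHodge

universe u v w

/-! ### Hochschild cochains of a (possibly non-unital) algebra with coefficients in itself -/

section Hochschild

/-- Hochschild `n`-cochains of `A` with coefficients in `A`: the `k`-multilinear maps `Aⁿ → A`. -/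
abbrev Cochain (k : Type u) (A : Type v) [Field k] [NonUnitalRing A] [Module k A] (n : ℕ) :
    Type v :=
  MultilinearMap k (fun _ : Fin n => A) A

variable {k : Type u} {A : Type v} [Field k] [NonUnitalRing A] [Module k A]

/-- The value of the Hochschild coboundary of `f` at `(a₁, …, aₙ₊₁)`:
`a₁ f(a₂, …) + ∑_{1 ≤ i ≤ n} (-1)^i f(…, aᵢ aᵢ₊₁, …) + (-1)^(n+1) f(a₁, …, aₙ) aₙ₊₁`. -/
def coboundaryFun {n : ℕ} (f : Cochain k A n) (a : Fin (n + 1) → A) : A :=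
  a 0 * f (fun i => a i.succ)
    + ∑ j : Fin n, (-1 : k) ^ ((j : ℕ) + 1) • f (Fin.contractNth j.castSucc (· * ·) a)
    + (-1 : k) ^ (n + 1) • (f (fun i => a i.castSucc) * a (Fin.last n))

variable [IsScalarTower k A A] [SMulCommClass k A A]

/-- Multiplying two neighbours in a tuple is linear in each entry of the tuple. -/
theorem contractNth_update {n : ℕ} (j : Fin n) (a : Fin (n + 1) → A) (i : Fin (n + 1)) :
    ∃ (l : Fin n) (g : A →ₗ[k] A), ∀ x, Fin.contractNth j.castSucc (· * ·) (Function.update a i x)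
      = Function.update (Fin.contractNth j.castSucc (· * ·) a) l (g x) := by
  rcases lt_trichotomy (i : ℕ) j with h | h | h
  · refine ⟨⟨i, by omega⟩, LinearMap.id, fun x => ?_⟩
    ext m
    simp only [Fin.contractNth, Function.update_apply, Fin.ext_iff, Fin.val_castSucc, Fin.val_succ,
      LinearMap.id_apply]
    split_ifs <;> first | rfl | (exfalso; omega)
  · refine ⟨j, LinearMap.mulRight k (a j.succ), fun x => ?_⟩
    ext m
    simp only [Fin.contractNth, Function.update_apply, Fin.ext_iff, Fin.val_castSucc, Fin.val_succ,
      LinearMap.mulRight_apply]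
    split_ifs <;> first | rfl | (exfalso; omega) | (congr 2; apply Fin.ext; simp; omega)
  · by_cases h' : (i : ℕ) = j + 1
    · refine ⟨j, LinearMap.mulLeft k (a j.castSucc), fun x => ?_⟩
      ext m
      simp only [Fin.contractNth, Function.update_apply, Fin.ext_iff, Fin.val_castSucc,
        Fin.val_succ, LinearMap.mulLeft_apply]
      split_ifs <;> first | rfl | (exfalso; omega) | (congr 2; apply Fin.ext; simp; omega)
    · refine ⟨⟨i - 1, by omega⟩, LinearMap.id, fun x => ?_⟩
      ext m
      simp only [Fin.contractNth, Function.update_apply, Fin.ext_iff, Fin.val_castSucc,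
        Fin.val_succ, LinearMap.id_apply]
      split_ifs <;> first | rfl | (exfalso; omega)

/-- The three kinds of terms of the coboundary are additive and homogeneous in each entry. -/
theorem coboundaryFun_update {n : ℕ} (f : Cochain k A n) (a : Fin (n + 1) → A) (i : Fin (n + 1)) :
    ∃ G : A →ₗ[k] A, ∀ x, coboundaryFun f (Function.update a i x) = G x := by
  have hmid : ∀ j : Fin n, ∃ G : A →ₗ[k] A, ∀ x,
      f (Fin.contractNth j.castSucc (· * ·) (Function.update a i x)) = G x := by
    intro j
    obtain ⟨l, g, hg⟩ := contractNth_update (k := k) j a i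
    exact ⟨(f.toLinearMap (Fin.contractNth j.castSucc (· * ·) a) l).comp g, fun x => by
      rw [hg]; rfl⟩
  have hleft : ∃ G : A →ₗ[k] A, ∀ x,
      Function.update a i x 0 * f (fun m => Function.update a i x m.succ) = G x := by
    induction i using Fin.cases with
    | zero =>
      exact ⟨LinearMap.mulRight k (f fun m => a m.succ), fun x => by simp⟩
    | succ i =>
      refine ⟨(LinearMap.mulLeft k (a 0)).comp (f.toLinearMap (fun m => a m.succ) i), fun x => ?_⟩
      have : (fun m : Fin n => Function.update a i.succ x m.succ)
          = Function.update (fun m => a m.succ) i x := by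
        ext m; simp [Function.update_apply]
      have h0 : Function.update a i.succ x 0 = a 0 :=
        Function.update_of_ne (Fin.succ_ne_zero i).symm _ _
      rw [this, h0]; simp
  have hright : ∃ G : A →ₗ[k] A, ∀ x,
      f (fun m => Function.update a i x m.castSucc) * Function.update a i x (Fin.last n)
        = G x := by
    induction i using Fin.lastCases with
    | last =>
      refine ⟨LinearMap.mulLeft k (f fun m => a m.castSucc), fun x => ?_⟩
      have : (fun m : Fin n => Function.update a (Fin.last n) x m.castSucc)
          = fun m => a m.castSucc := by
        ext m; simp
      rw [this]; simp
    | cast i =>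
      refine ⟨(LinearMap.mulRight k (a (Fin.last n))).comp
        (f.toLinearMap (fun m => a m.castSucc) i), fun x => ?_⟩
      have : (fun m : Fin n => Function.update a i.castSucc x m.castSucc)
          = Function.update (fun m => a m.castSucc) i x := by
        ext m; simp [Function.update_apply]
      rw [this]; simp [Fin.ext_iff, (i.isLt).ne']
  choose Gm hGm using hmid
  obtain ⟨Gl, hGl⟩ := hleft
  obtain ⟨Gr, hGr⟩ := hright
  refine ⟨Gl + ∑ j : Fin n, (-1 : k) ^ ((j : ℕ) + 1) • Gm j + (-1 : k) ^ (n + 1) • Gr,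
    fun x => ?_⟩
  simp only [coboundaryFun, hGm, hGl, hGr, LinearMap.add_apply, LinearMap.sum_apply,
    LinearMap.smul_apply]

/-- The Hochschild coboundary `δ : Cⁿ(A, A) → Cⁿ⁺¹(A, A)`. -/
def coboundary (k : Type u) (A : Type v) [Field k] [NonUnitalRing A] [Module k A]
    [IsScalarTower k A A] [SMulCommClass k A A] (n : ℕ) :
    Cochain k A n →ₗ[k] Cochain k A (n + 1) where
  toFun f :=
    { toFun := coboundaryFun f
      map_update_add' := by
        intro inst a i x y
        rw [Subsingleton.elim inst (instDecidableEqFin _)]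
        obtain ⟨G, hG⟩ := coboundaryFun_update f a i
        simp only [hG, map_add]
      map_update_smul' := by
        intro inst a i c x
        rw [Subsingleton.elim inst (instDecidableEqFin _)]
        obtain ⟨G, hG⟩ := coboundaryFun_update f a i
        simp only [hG, map_smul] }
  map_add' f g := by
    ext a
    simp only [coboundaryFun, MultilinearMap.coe_mk, add_apply, mul_add, add_mul,
      smul_add, Finset.sum_add_distrib]
    abel
  map_smul' c f := by
    ext a
    simp only [coboundaryFun, MultilinearMap.coe_mk, smul_apply, smul_add,
      Finset.smul_sum, mul_smul_comm, smul_mul_assoc, RingHom.id_apply, smul_comm _ c]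

end Hochschild

/-! ### Subcomplexes of the Hochschild complex and their cohomology -/

section Subcomplex

variable (k : Type u) (A : Type v) [Field k] [NonUnitalRing A] [Module k A]

/-- A graded subspace of the Hochschild cochains `C*(A, A)`. -/
abbrev GradedSub : Type v := ∀ n : ℕ, Submodule k (Cochain k A n)

variable {k A} [IsScalarTower k A A] [SMulCommClass k A A]

/-- `V` is a subcomplex: stable under `δ`, and `δ ∘ δ = 0` on it. -/
structure IsSubcomplex (V : GradedSub k A) : Prop where
  coboundary_mem : ∀ n, ∀ f ∈ V n, coboundary k A n f ∈ V (n + 1)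
  coboundary_coboundary : ∀ n, ∀ f ∈ V n, coboundary k A (n + 1) (coboundary k A n f) = 0

/-- The `n`-cocycles of `V`. -/
def cocycles (V : GradedSub k A) (n : ℕ) : Submodule k (Cochain k A n) :=
  V n ⊓ LinearMap.ker (coboundary k A n)

/-- The `n`-coboundaries of `V`: the image `δ (V (n - 1))`, and `0` for `n = 0`. -/
def coboundaries (V : GradedSub k A) : ∀ n : ℕ, Submodule k (Cochain k A n)
  | 0 => ⊥
  | n + 1 => (V n).map (coboundary k A n)

/-- The cohomology `Hⁿ(V)`: cocycles of `V` modulo coboundaries of `V`. -/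
abbrev Cohomology (V : GradedSub k A) (n : ℕ) : Type v :=
  ↥(cocycles V n) ⧸ (coboundaries V n).submoduleOf (cocycles V n)

theorem cocycles_mono {V W : GradedSub k A} (h : ∀ n, V n ≤ W n) (n : ℕ) :
    cocycles V n ≤ cocycles W n :=
  inf_le_inf_right _ (h n)

theorem coboundaries_mono {V W : GradedSub k A} (h : ∀ n, V n ≤ W n) :
    ∀ n, coboundaries V n ≤ coboundaries W n
  | 0 => le_rfl
  | n + 1 => Submodule.map_mono (h n)

/-- The map `Hⁿ(V) → Hⁿ(W)` induced by an inclusion `V ⊆ W`. -/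
def cohomologyMap {V W : GradedSub k A} (h : ∀ n, V n ≤ W n) (n : ℕ) :
    Cohomology V n →ₗ[k] Cohomology W n :=
  Submodule.mapQ _ _ (Submodule.inclusion (cocycles_mono h n))
    (fun _ hx => coboundaries_mono h n hx)

/-- The graded subspace `e(W)`, for a graded endomorphism `e` of `C*(A, A)`. -/
def imagePart (W : GradedSub k A) (e : ∀ n, Module.End k (Cochain k A n)) : GradedSub k A :=
  fun n => (W n).map (e n)

open scoped DirectSum in
/-- The graded endomorphisms `e i`, `i ∈ I`, decompose the complex `W` into the direct sum of the
subcomplexes `e i (W)`, and `H*(W)` into the direct sum of the `H*(e i (W))`. -/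
structure DecomposesBy {I : Type w} [DecidableEq I] (W : GradedSub k A)
    (e : I → ∀ n, Module.End k (Cochain k A n)) : Prop where
  /-- `W` is itself a complex. -/
  isSubcomplex : IsSubcomplex W
  /-- Each `e i` maps `W` to itself. -/
  mapsTo : ∀ i n, ∀ f ∈ W n, e i n f ∈ W n
  /-- Each `e i` commutes with the coboundary. -/
  comm : ∀ i n, ∀ f ∈ W n, coboundary k A n (e i n f) = e i (n + 1) (coboundary k A n f)
  /-- The `e i` are idempotent. -/
  idem : ∀ i n, ∀ f ∈ W n, e i n (e i n f) = e i n f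
  /-- The `e i` are pairwise orthogonal. -/
  orth : ∀ i j, i ≠ j → ∀ n, ∀ f ∈ W n, e i n (e j n f) = 0
  /-- The images are subcomplexes. -/
  isSubcomplex_part : ∀ i, IsSubcomplex (imagePart W (e i))
  /-- The sum of the images is direct. -/
  independent : ∀ n, iSupIndep fun i => imagePart W (e i) n
  /-- The images span `W`. -/
  iSup_eq : ∀ n, ⨆ i, imagePart W (e i) n = W n
  /-- The inclusions of the summands induce an isomorphism from the direct sum of their cohomologies
  onto the cohomology of `W`. -/
  cohomology : ∃ hle : ∀ i n, imagePart W (e i) n ≤ W n, ∀ n,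
    Function.Bijective (DirectSum.toModule k I (Cohomology W n)
      (fun i => cohomologyMap (hle i) n) :
        (⨁ i, Cohomology (imagePart W (e i)) n) →ₗ[k] Cohomology W n)

end Subcomplex

/-! ### The Gerstenhaber–Schack (Eulerian) idempotents -/

section Eulerian

open Polynomial

/-- The number of descents of `σ`, i.e. of positions `i` with `σ (i + 1) < σ i`. -/
def descents {n : ℕ} (σ : Equiv.Perm (Fin n)) : ℕ :=
  (Finset.univ.filter fun i : Fin n => ∃ h : (i : ℕ) + 1 < n, σ ⟨i + 1, h⟩ < σ i).card

/-- The polynomial `binom (X - 1 - d + n, n) = (1 / n!) ∏_{0 ≤ l < n} (X + n - 1 - d - l)`. -/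
def binomPoly (n d : ℕ) : ℚ[X] :=
  C ((n.factorial : ℚ)⁻¹) * ∏ l ∈ Finset.range n, (X + C ((n : ℚ) - 1 - d - l))

/-- The `i`-th Eulerian idempotent `eₙ⁽ⁱ⁾ ∈ ℚ[Sₙ]`, as a function on `Sₙ`. It is defined by
`∑ᵢ eₙ⁽ⁱ⁾ Xⁱ = ∑_σ sgn(σ) binom (X - 1 - des(σ) + n, n) σ`. -/
def eulerianCoeff (n i : ℕ) (σ : Equiv.Perm (Fin n)) : ℚ :=
  ((Equiv.Perm.sign σ : ℤ) : ℚ) * (binomPoly n (descents σ)).coeff i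

/-- The coefficient of `σ` in `∑_{i ∈ J} eₙ⁽ⁱ⁾ ∈ ℚ[Sₙ]`. -/
def eulerianSum (n : ℕ) (J : Finset ℕ) (σ : Equiv.Perm (Fin n)) : ℚ :=
  ∑ i ∈ J, eulerianCoeff n i σ

/-- The action on `n`-cochains of `∑_{i ∈ J} eₙ⁽ⁱ⁾`, with its coefficients taken in `k`. Here
`σ ∈ Sₙ` acts by `(σ f)(a₁, …, aₙ) = f (a_{σ⁻¹(1)}, …, a_{σ⁻¹(n)})`. The coefficients have a meaning
in `k` if their denominators are invertible there. -/
def eulerianOp (k : Type u) (A : Type v) [Field k] [NonUnitalRing A] [Module k A] (n : ℕ)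
    (J : Finset ℕ) : Module.End k (Cochain k A n) :=
  ∑ σ : Equiv.Perm (Fin n), ((eulerianSum n J σ : ℚ) : k) •
    (MultilinearMap.domDomCongrLinearEquiv k k A A σ⁻¹).toLinearMap

/-- The indices `1 ≤ j ≤ n` congruent to `i` modulo `p - 1`. -/
def residueClass (p n i : ℕ) : Finset ℕ :=
  (Finset.Icc 1 n).filter fun j => j ≡ i [MOD p - 1]

end Eulerian

/-! ### Semigroup algebras and coherent cochains -/

section Coherent

/-- The product `s₁ s₂ ⋯ sₙ₊₁` of a nonempty sequence. -/
def seqProd {S : Type w} [Mul S] : ∀ n : ℕ, (Fin (n + 1) → S) → S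
  | 0, s => s 0
  | n + 1, s => seqProd n (fun i => s i.castSucc) * s (Fin.last (n + 1))

/-- The coherent cochains of an algebra `A` spanned by the image of `ι : S → A`:
`CC⁰ = 0`, and for `n > 0` the cochain `f ∈ Cⁿ(A, A)` is coherent if `f (s₁, …, sₙ)` is a scalar
multiple of `s₁ ⋯ sₙ` for all `s₁, …, sₙ` in `S`. -/
def coherent {k : Type u} {A : Type v} [Field k] [NonUnitalRing A] [Module k A] {S : Type w}
    [Mul S] (ι : S →ₙ* A) : GradedSub k A
  | 0 => ⊥
  | n + 1 =>
    { carrier := {f | ∀ s : Fin (n + 1) → S, ∃ c : k, f (fun i => ι (s i)) = c • ι (seqProd n s)}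
      zero_mem' := fun _ => ⟨0, by simp⟩
      add_mem' := by
        intro f g hf hg s
        obtain ⟨c, hc⟩ := hf s
        obtain ⟨d, hd⟩ := hg s
        exact ⟨c + d, by rw [add_apply, hc, hd, add_smul]⟩
      smul_mem' := by
        intro r f hf s
        obtain ⟨c, hc⟩ := hf s
        exact ⟨r * c, by rw [smul_apply, hc, mul_smul]⟩ }

variable (k : Type u) [Field k] {S : Type w} [CommSemigroup S] (z : S)

/-- The congruence on the semigroup algebra `k[S]` that identifies the multiples of `z` with `0`. -/
def contractCon : RingCon (MonoidAlgebra k S) :=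
  ringConGen fun x y => (∃ c : k, x = MonoidAlgebra.single z c) ∧ y = 0

/-- The (contracted) semigroup algebra of a commutative semigroup with zero element `z`: the algebra
`k[S] / k z`, in which the zero of the semigroup is the zero of the algebra. -/
def ContractedAlgebra : Type (max u w) := (contractCon k z).Quotient

instance : NonUnitalCommRing (ContractedAlgebra k z) :=
  inferInstanceAs (NonUnitalCommRing (contractCon k z).Quotient)

theorem contractCon_smul (r : k) {x y : MonoidAlgebra k S} (h : contractCon k z x y) :
    contractCon k z (r • x) (r • y) := by
  change RingConGen.Rel _ x y at h
  change RingConGen.Rel _ (r • x) (r • y)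
  induction h with
  | of x y hxy =>
    obtain ⟨⟨c, rfl⟩, rfl⟩ := hxy
    exact RingConGen.Rel.of _ _ ⟨⟨r * c, by simp⟩, by simp⟩
  | refl x => exact RingConGen.Rel.refl _
  | symm h ih => exact RingConGen.Rel.symm ih
  | trans h₁ h₂ ih₁ ih₂ => exact RingConGen.Rel.trans ih₁ ih₂
  | add h₁ h₂ ih₁ ih₂ =>
    rw [smul_add, smul_add]
    exact RingConGen.Rel.add ih₁ ih₂
  | mul h₁ h₂ ih₁ ih₂ =>
    rw [← smul_mul_assoc, ← smul_mul_assoc]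
    exact RingConGen.Rel.mul ih₁ h₂

/-- The projection `k[S] → k[S] / k z`, as an additive map. -/
def contractMk : MonoidAlgebra k S →+ ContractedAlgebra k z where
  toFun x := (contractCon k z).toQuotient x
  map_zero' := rfl
  map_add' _ _ := rfl

theorem contractMk_surjective : Function.Surjective (contractMk k z) :=
  Quotient.mk''_surjective

instance : SMul k (ContractedAlgebra k z) where
  smul r := Quotient.map' (r • ·) fun _ _ h => contractCon_smul k z r h

instance : Module k (ContractedAlgebra k z) :=
  Function.Surjective.module k (contractMk k z) (contractMk_surjective k z) fun _ _ => rfl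

instance : IsScalarTower k (ContractedAlgebra k z) (ContractedAlgebra k z) where
  smul_assoc r x y := by
    obtain ⟨x, rfl⟩ := contractMk_surjective k z x
    obtain ⟨y, rfl⟩ := contractMk_surjective k z y
    exact congrArg (contractMk k z) (smul_mul_assoc r x y)

instance : SMulCommClass k (ContractedAlgebra k z) (ContractedAlgebra k z) where
  smul_comm r x y := by
    obtain ⟨x, rfl⟩ := contractMk_surjective k z x
    obtain ⟨y, rfl⟩ := contractMk_surjective k z y
    exact congrArg (contractMk k z) (mul_smul_comm r x y).symm

/-- The map from `S` to its contracted algebra. -/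
def toContracted : S →ₙ* ContractedAlgebra k z where
  toFun s := contractMk k z (MonoidAlgebra.ofMagma k S s)
  map_mul' s t := congrArg (contractMk k z) (map_mul (MonoidAlgebra.ofMagma k S) s t)

/-- The graded endomorphism of `C*(A, A)` given by the Eulerian idempotents `eₙ⁽ⁱ⁾`. -/
def hodgeOp (A : Type v) [NonUnitalRing A] [Module k A] (i : ℕ) :
    ∀ n, Module.End k (Cochain k A n) :=
  fun n => eulerianOp k A n {i}

/-- The graded endomorphism of `C*(A, A)` given by the sums of the Eulerian idempotents `eₙ⁽ʲ⁾` over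
all `1 ≤ j ≤ n` with `j ≡ i` modulo `p - 1`. -/
def hodgeOpMod (p : ℕ) (A : Type v) [NonUnitalRing A] [Module k A] (i : ℕ) :
    ∀ n, Module.End k (Cochain k A n) :=
  fun n => eulerianOp k A n (residueClass p n i)

end Coherent

end CoherentHodge

end

noncomputable section

namespace CoherentHodge

universe u v w

/-! ### Stable sorting of words -/

section SortLemmas

open Equiv.Perm Tuple

variable {α β : Type*} [LinearOrder α] [LinearOrder β]

/-! The Eulerian idempotents are the spectral projections of the Adams operations. Let `ψᵐ` act on
an `n`-cochain by all signed riffle shuffles of its arguments with `m` piles: a word `w` in `m`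
letters tells which pile fills which slot, and the shuffle is the stable sorting permutation of `w`.
Three facts carry the proof.

The operations commute with `δ` when `A` is commutative (`coboundary_adamsOp`). In the interior
terms, words with distinct letters at the two multiplied slots cancel in pairs and words with equal
letters contract. In the two outer terms, moving the border between neighbouring piles cancels
everything that is not wanted.

The operations multiply, `ψᵃψᵇ = ψᵃᵇ`, because sorting twice is sorting lexicographically
(`conv_wordCoeff`). The number of words sorted by `σ` is a binomial coefficient in `m` and `des σ`
(`card_sort_eq`), so that `ψᵐ = ∑ⱼ mʲ eₙ⁽ʲ⁾` (`wordCoeff_eq`).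

Comparing coefficients of powers of `m` gives orthogonality over `ℚ` and, in characteristic zero,
commutation with `δ`. The case `m = 1` shows that the idempotents add up to the identity. In
characteristic `p` one evaluates `ψᵐ` at approximate Teichmüller representatives `m = u ^ p ^ N` of
the units mod `p`. Orthogonality of characters then isolates one residue class of `j` mod `p - 1`,
with error divisible by `p` once `p ^ N` has absorbed the denominators (`eulerianSum_residueClass`).
This gives integrality and writes each summed idempotent as a combination of Adams operations.

Coherence is preserved because products in `S` do not depend on the order of the factors. Only
commutativity of `A` and multiplicativity of `ι` enter, so the full and the contracted semigroup
algebra are treated together. The splitting of cohomology is then formal. -/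

theorem sort_orderIso_comp {n : ℕ} (e : α ≃o β) (w : Fin n → α) :
    Tuple.sort (fun i => e (w i)) = Tuple.sort w := by
  symm
  rw [eq_sort_iff]
  have h := (eq_sort_iff (f := w) (σ := Tuple.sort w)).1 rfl
  exact ⟨fun i j hij => e.monotone (h.1 hij), fun i j hij he => h.2 i j hij (e.injective he)⟩

/-- Sorting first by `w` and then by `v` sorts lexicographically. -/
theorem sort_toLex {n : ℕ} (v : Fin n → β) (w : Fin n → α) :
    Tuple.sort (fun i => toLex (v ((Tuple.sort w)⁻¹ i), w i)) = Tuple.sort w * Tuple.sort v := by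
  symm
  rw [eq_sort_iff]
  have hw := (eq_sort_iff (f := w) (σ := Tuple.sort w)).1 rfl
  have hv := (eq_sort_iff (f := v) (σ := Tuple.sort v)).1 rfl
  constructor
  · intro i j hij
    rcases hij.eq_or_lt with rfl | hlt
    · rfl
    simp only [Function.comp_apply, Prod.Lex.toLex_le_toLex, Equiv.Perm.mul_apply,
      Equiv.Perm.inv_def, Equiv.symm_apply_apply]
    -- On ties in `v`, stability of its sort keeps the positions increasing, and these positions are
    -- ranks for `w`, so `w` cannot decrease.
    rcases (hv.1 hij).lt_or_eq with h | h
    · exact Or.inl h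
    · exact Or.inr ⟨h, hw.1 (hv.2 i j hlt h).le⟩
  · intro i j hij h
    simp only [Equiv.Perm.mul_apply, Equiv.Perm.inv_def, Equiv.symm_apply_apply, EmbeddingLike.apply_eq_iff_eq,
      Prod.mk.injEq] at h
    exact hw.2 _ _ (hv.2 i j hij h.1) h.2

/-- Deleting `i` from the domain and `σ i` from the codomain of a permutation `σ`. -/
theorem exists_perm_succAbove {n : ℕ} (σ : Equiv.Perm (Fin (n + 1))) (i : Fin (n + 1)) :
    ∃ τ : Equiv.Perm (Fin n), (∀ l, σ (i.succAbove l) = (σ i).succAbove (τ l)) ∧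
      sign σ = (-1) ^ ((i : ℕ) + (σ i : ℕ)) * sign τ := by
  -- Cycling `i` and `σ i` to the front gives a permutation fixing `0`, whose restriction is `τ`.
  -- The two cycles contribute the sign.
  obtain ⟨⟨p, τ⟩, hτ⟩ := Equiv.Perm.decomposeFin.symm.surjective
    ((σ i).cycleRange * σ * i.cycleRange⁻¹)
  have h0 : p = 0 := by
    have := congrArg (fun π => π 0) hτ
    simpa [Equiv.Perm.inv_def, Fin.cycleRange_symm_zero] using this
  subst h0
  refine ⟨τ, fun l => ?_, ?_⟩
  · have := congrArg (fun π => π l.succ) hτ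
    simp only [Equiv.Perm.decomposeFin_symm_apply_succ, Equiv.swap_self, Equiv.refl_apply,
      Equiv.Perm.mul_apply, Equiv.Perm.inv_def, Fin.cycleRange_symm_succ] at this
    apply (σ i).cycleRange.injective
    rw [← this, Fin.cycleRange_succAbove]
  · have := congrArg sign hτ
    simp only [Equiv.Perm.decomposeFin.symm_sign, if_true, one_mul, Equiv.Perm.sign_mul, sign_inv,
      Fin.sign_cycleRange] at this
    rw [this, pow_add]
    generalize ((-1 : ℤˣ) ^ (i : ℕ)) = x
    generalize ((-1 : ℤˣ) ^ (σ i : ℕ)) = y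
    generalize sign σ = z
    rcases Int.units_eq_one_or x with rfl | rfl <;> rcases Int.units_eq_one_or y with rfl | rfl <;>
      simp

/-- Deleting a letter does not disturb the relative order of the others. Here `j` is the position of
the letter and `i` its rank. -/
theorem sort_succAbove {n : ℕ} (w : Fin (n + 1) → α) {i j : Fin (n + 1)}
    (h : Tuple.sort w i = j) :
    (∀ l, Tuple.sort w (i.succAbove l) = j.succAbove (Tuple.sort (w ∘ j.succAbove) l)) ∧
      sign (Tuple.sort w) = (-1) ^ ((i : ℕ) + (j : ℕ)) * sign (Tuple.sort (w ∘ j.succAbove)) := by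
  subst h
  obtain ⟨τ, h₁, h₂⟩ := exists_perm_succAbove (Tuple.sort w) i
  have hw := (eq_sort_iff (f := w) (σ := Tuple.sort w)).1 rfl
  have : τ = Tuple.sort (w ∘ (Tuple.sort w i).succAbove) := by
    rw [eq_sort_iff]
    constructor
    · intro x y hxy
      simp only [Function.comp_apply, ← h₁]
      exact hw.1 ((Fin.strictMono_succAbove i).monotone hxy)
    · intro x y hxy he
      simp only [Function.comp_apply, ← h₁] at he
      have := hw.2 _ _ (Fin.strictMono_succAbove i hxy) he
      rw [h₁, h₁] at this
      exact (Fin.strictMono_succAbove _).lt_iff_lt.1 this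
  exact this ▸ ⟨h₁, h₂⟩

/-- Stable sorting orders positions by (letter, position), so a rank counts predecessors. Ranks in
different words can then be compared as cardinalities. -/
theorem sort_inv_apply {n : ℕ} (w : Fin n → α) (j : Fin n) :
    (((Tuple.sort w)⁻¹ j : Fin n) : ℕ)
      = (Finset.univ.filter fun t => w t < w j ∨ w t = w j ∧ t < j).card := by
  have hw := (eq_sort_iff (f := w) (σ := Tuple.sort w)).1 rfl
  have key : ∀ x y, x < y → (w (Tuple.sort w x) < w (Tuple.sort w y) ∨
      w (Tuple.sort w x) = w (Tuple.sort w y) ∧ Tuple.sort w x < Tuple.sort w y) := by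
    intro x y hxy
    rcases (hw.1 hxy.le).lt_or_eq with h | h
    · exact Or.inl h
    · exact Or.inr ⟨h, hw.2 x y hxy h⟩
  have : (Finset.univ.filter fun t => w t < w j ∨ w t = w j ∧ t < j)
      = (Finset.Iio ((Tuple.sort w)⁻¹ j)).map (Tuple.sort w).toEmbedding := by
    ext t
    simp only [Finset.mem_filter, Finset.mem_univ, true_and, Finset.mem_map_equiv,
      Finset.mem_Iio]
    obtain ⟨y, rfl⟩ := (Tuple.sort w).surjective j
    obtain ⟨x, rfl⟩ := (Tuple.sort w).surjective t
    rw [Equiv.Perm.inv_def, Equiv.symm_apply_apply, Equiv.symm_apply_apply]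
    constructor
    · intro h
      by_contra hc
      rcases (not_lt.1 hc).eq_or_lt with rfl | hlt
      · simp at h
      · rcases key _ _ hlt with h' | h'
        · rcases h with h | h
          · exact lt_asymm h h'
          · exact h'.ne' h.1
        · rcases h with h | h
          · exact h.ne' h'.1
          · exact lt_asymm h.2 h'.2
    · exact key x y
  rw [this, Finset.card_map, Fin.card_Iio]

theorem sort_comp_swap {n : ℕ} (w : Fin (n + 1) → α) (j : Fin n)
    (h : w j.castSucc ≠ w j.succ) :
    Tuple.sort (w ∘ Equiv.swap j.castSucc j.succ)
      = Equiv.swap j.castSucc j.succ * Tuple.sort w := by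
  symm
  rw [eq_sort_iff]
  have hw := (eq_sort_iff (f := w) (σ := Tuple.sort w)).1 rfl
  constructor
  · intro x y hxy
    simpa using hw.1 hxy
  · intro x y hxy he
    simp only [Function.comp_apply, Equiv.Perm.mul_apply, Equiv.swap_apply_self] at he ⊢
    have h1 := hw.2 x y hxy he
    generalize Tuple.sort w x = a at *
    generalize Tuple.sort w y = b at *
    simp only [Equiv.swap_apply_def]
    split_ifs with h1 h2 h3 h4 h5 h6 <;> subst_vars <;>
      simp_all only [Fin.lt_def, Fin.ext_iff, Fin.val_castSucc, Fin.val_succ, ne_eq,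
        not_true_eq_false] <;> omega

end SortLemmas

/-! ### Adams operations and their commutation with the coboundary -/

section Adams

variable (k : Type u) (A : Type v) [Field k] [NonUnitalRing A] [Module k A]

/-- The Adams operation `ψᵐ` on `n`-cochains: the signed sum over all words `w` of length `n` in `m`
letters of the permutations that sort them. -/
def adamsOp (n m : ℕ) : Module.End k (Cochain k A n) :=
  ∑ w : Fin n → Fin m, ((Equiv.Perm.sign (Tuple.sort w) : ℤ) : k) •
    (MultilinearMap.domDomCongrLinearEquiv k k A A (Tuple.sort w)⁻¹).toLinearMap

variable {k A}

theorem adamsOp_apply {n m : ℕ} (f : Cochain k A n) (a : Fin n → A) :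
    adamsOp k A n m f a = ∑ w : Fin n → Fin m,
      ((Equiv.Perm.sign (Tuple.sort w) : ℤ) : k) • f (fun i => a ((Tuple.sort w)⁻¹ i)) := by
  simp only [adamsOp, LinearMap.sum_apply, LinearMap.smul_apply, sum_apply, smul_apply]
  rfl

end Adams

section Positions

variable {m n : ℕ}

/-- Where the leading letter of a word comes from. -/
theorem sort_inv_cons_succ (l : Fin m) (u : Fin n → Fin (m + 1)) :
    (((Tuple.sort (Fin.cons l.succ u : Fin (n + 1) → Fin (m + 1)))⁻¹ 0 : Fin (n + 1)) : ℕ)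
      = (Finset.univ.filter fun t => u t ≤ l.castSucc).card := by
  rw [sort_inv_apply]
  simp only [Fin.card_filter_univ_succ, Fin.cons_zero, Fin.cons_succ, lt_self_iff_false,
    and_false, or_false, if_false, Fin.not_lt_zero]
  exact congrArg _ (Finset.filter_congr fun t _ => by simp [Fin.lt_def, Fin.le_def])

theorem sort_inv_cons_zero (u : Fin n → Fin (m + 1)) :
    (Tuple.sort (Fin.cons 0 u : Fin (n + 1) → Fin (m + 1)))⁻¹ 0 = 0 := by
  apply Fin.ext
  rw [sort_inv_apply]
  simp

theorem sort_inv_snoc (l : Fin (m + 1)) (u : Fin n → Fin (m + 1)) :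
    (((Tuple.sort (Fin.snoc u l : Fin (n + 1) → Fin (m + 1)))⁻¹ (Fin.last n) : Fin (n + 1)) : ℕ)
      = (Finset.univ.filter fun t => u t ≤ l).card := by
  have : (Finset.univ.filter fun t => (Fin.snoc u l : Fin (n + 1) → Fin (m + 1)) t
        < (Fin.snoc u l : Fin (n + 1) → Fin (m + 1)) (Fin.last n) ∨
      (Fin.snoc u l : Fin (n + 1) → Fin (m + 1)) t
        = (Fin.snoc u l : Fin (n + 1) → Fin (m + 1)) (Fin.last n) ∧ t < Fin.last n)
      = (Finset.univ.filter fun t => u t ≤ l).map Fin.castSuccEmb := by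
    ext t
    induction t using Fin.lastCases with
    | last => simp
    | cast t => simp [Fin.castSucc_lt_last, le_iff_lt_or_eq]
  rw [sort_inv_apply, this, Finset.card_map]

theorem sort_inv_snoc_last (u : Fin n → Fin (m + 1)) :
    (Tuple.sort (Fin.snoc u (Fin.last m) : Fin (n + 1) → Fin (m + 1)))⁻¹ (Fin.last n)
      = Fin.last n := by
  apply Fin.ext
  rw [sort_inv_snoc]
  simp [Fin.le_last]

/-- Two equal neighbouring letters come from neighbouring positions. -/
theorem sort_inv_succ_of_eq (w : Fin (n + 1) → Fin m) (j : Fin n)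
    (h : w j.castSucc = w j.succ) :
    (Tuple.sort w)⁻¹ j.castSucc = ((Tuple.sort (w ∘ j.succ.succAbove))⁻¹ j).castSucc ∧
    (Tuple.sort w)⁻¹ j.succ = ((Tuple.sort (w ∘ j.succ.succAbove))⁻¹ j).succ := by
  have h1 : (((Tuple.sort w)⁻¹ j.succ : Fin (n + 1)) : ℕ)
      = ((Tuple.sort w)⁻¹ j.castSucc : Fin (n + 1)) + 1 := by
    -- The second copy has exactly one predecessor more than the first, namely the first copy
    -- itself.
    rw [sort_inv_apply, sort_inv_apply, ← Finset.card_insert_of_notMem (a := j.castSucc) (by simp)]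
    congr 1
    ext t
    simp only [Finset.mem_filter, Finset.mem_univ, true_and, Finset.mem_insert, ← h,
      Fin.lt_def, Fin.ext_iff, Fin.val_succ, Fin.val_castSucc]
    constructor
    · rintro (h' | ⟨h', h''⟩)
      · exact Or.inr (Or.inl h')
      · rcases Nat.lt_succ_iff_lt_or_eq.1 h'' with h3 | h3
        · exact Or.inr (Or.inr ⟨h', h3⟩)
        · exact Or.inl h3
    · rintro (h' | h' | ⟨h', h''⟩)
      · exact Or.inr ⟨by rw [show t = j.castSucc from Fin.ext h'], by omega⟩
      · exact Or.inl h'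
      · exact Or.inr ⟨h', by omega⟩
  obtain ⟨x, hx⟩ : ∃ x, (Tuple.sort w)⁻¹ j.succ = x := ⟨_, rfl⟩
  obtain ⟨y, hy⟩ : ∃ x, (Tuple.sort w)⁻¹ j.castSucc = x := ⟨_, rfl⟩
  rw [hx, hy] at h1
  rw [hx, hy]
  have hyn : (y : ℕ) < n := by omega
  obtain ⟨y, rfl⟩ : ∃ z : Fin n, y = z.castSucc := ⟨⟨y, hyn⟩, rfl⟩
  obtain rfl : x = y.succ := Fin.ext (by simpa using h1)
  have hs : Tuple.sort w y.succ = j.succ := by rw [← hx]; simp [Equiv.Perm.inv_def]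
  have hc : Tuple.sort w y.castSucc = j.castSucc := by rw [← hy]; simp [Equiv.Perm.inv_def]
  have h2 : Tuple.sort (w ∘ j.succ.succAbove) y = j := by
    have h3 := (sort_succAbove w hs).1 y
    rw [Fin.succAbove_of_castSucc_lt _ _ y.castSucc_lt_succ, hc] at h3
    apply j.succ.succAbove_right_injective
    rw [← h3, Fin.succAbove_of_castSucc_lt _ _ j.castSucc_lt_succ]
  have h4 : (Tuple.sort (w ∘ j.succ.succAbove))⁻¹ j = y := by
    rw [Equiv.Perm.inv_eq_iff_eq, h2]
  rw [h4]
  exact ⟨rfl, rfl⟩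

end Positions

section Commute

variable {n m : ℕ} {B : Type*}

/-- Deleting a letter from a word, and the corresponding entry from a tuple. -/
theorem comp_sort_inv_succAbove (w : Fin (n + 1) → Fin m) {i j : Fin (n + 1)}
    (h : (Tuple.sort w)⁻¹ j = i) (a : Fin (n + 1) → B) (l : Fin n) :
    a ((Tuple.sort w)⁻¹ (j.succAbove l))
      = a (i.succAbove ((Tuple.sort (w ∘ j.succAbove))⁻¹ l)) := by
  have h' : Tuple.sort w i = j := by rw [← h]; simp [Equiv.Perm.inv_def]
  have := (sort_succAbove w h').1 ((Tuple.sort (w ∘ j.succAbove))⁻¹ l)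
  congr 1
  rw [Equiv.Perm.inv_eq_iff_eq, this]
  simp [Equiv.Perm.inv_def]

theorem sign_sort_succAbove (w : Fin (n + 1) → Fin m) {i j : Fin (n + 1)}
    (h : (Tuple.sort w)⁻¹ j = i) (k : Type*) [Ring k] :
    ((Equiv.Perm.sign (Tuple.sort w) : ℤ) : k) = (-1) ^ ((i : ℕ) + (j : ℕ)) *
      ((Equiv.Perm.sign (Tuple.sort (w ∘ j.succAbove)) : ℤ) : k) := by
  have h' : Tuple.sort w i = j := by rw [← h]; simp [Equiv.Perm.inv_def]
  rw [(sort_succAbove w h').2]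
  push_cast
  simp

/-- A repeated letter can be contracted. -/
theorem contractNth_comp_sort_inv [Mul B] (w : Fin (n + 1) → Fin m) (j : Fin n)
    (h : w j.castSucc = w j.succ) (a : Fin (n + 1) → B) :
    Fin.contractNth j.castSucc (· * ·) (fun i => a ((Tuple.sort w)⁻¹ i))
      = fun l => Fin.contractNth ((Tuple.sort (w ∘ j.succ.succAbove))⁻¹ j).castSucc (· * ·) a
          ((Tuple.sort (w ∘ j.succ.succAbove))⁻¹ l) := by
  obtain ⟨h1, h2⟩ := sort_inv_succ_of_eq w j h
  have key : ∀ {n : ℕ} {p q : Fin n}, (q : ℕ) ≠ p →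
      p.castSucc.succAbove q = p.succ.succAbove q := by
    intro n p q hpq
    simp only [Fin.succAbove, Fin.lt_def, Fin.val_castSucc, Fin.val_succ]
    split_ifs <;> first | rfl | (exfalso; omega)
  funext l
  by_cases hl : l = j
  · subst hl
    rw [Fin.contractNth_apply_of_eq _ _ _ _ rfl, Fin.contractNth_apply_of_eq _ _ _ _ rfl, h1, h2]
  · have hl' : (l : ℕ) ≠ j := fun h => hl (Fin.ext h)
    have hl'' : (((Tuple.sort (w ∘ j.succ.succAbove))⁻¹ l : Fin n) : ℕ)
        ≠ ((Tuple.sort (w ∘ j.succ.succAbove))⁻¹ j : Fin n) :=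
      fun h => hl ((Tuple.sort (w ∘ j.succ.succAbove))⁻¹.injective (Fin.ext h))
    rw [Fin.contractNth_apply_of_ne _ _ _ _ hl'.symm, Fin.contractNth_apply_of_ne _ _ _ _ hl''.symm,
      key hl', key hl'', comp_sort_inv_succAbove w h2 a]

/-- Exchanging two distinct neighbouring letters does not affect the contraction. -/
theorem contractNth_comp_sort_inv_swap [CommMagma B] (w : Fin (n + 1) → Fin m) (j : Fin n)
    (h : w j.castSucc ≠ w j.succ) (a : Fin (n + 1) → B) :
    Fin.contractNth j.castSucc (· * ·)
        (fun i => a ((Tuple.sort (w ∘ Equiv.swap j.castSucc j.succ))⁻¹ i))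
      = Fin.contractNth j.castSucc (· * ·) (fun i => a ((Tuple.sort w)⁻¹ i)) := by
  rw [sort_comp_swap w j h]
  funext l
  simp only [mul_inv_rev, Equiv.swap_inv, Equiv.Perm.mul_apply]
  by_cases hl : l = j
  · subst hl
    rw [Fin.contractNth_apply_of_eq _ _ _ _ rfl, Fin.contractNth_apply_of_eq _ _ _ _ rfl]
    simp [mul_comm]
  · have hl' : (l : ℕ) ≠ j := fun h => hl (Fin.ext h)
    rw [Fin.contractNth_apply_of_ne _ _ _ _ hl'.symm, Fin.contractNth_apply_of_ne _ _ _ _ hl'.symm,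
      Equiv.swap_apply_of_ne_of_ne (Fin.succAbove_ne _ _)]
    simp only [Fin.succAbove, ne_eq, Fin.ext_iff, Fin.lt_def, Fin.val_succ]
    split_ifs with h3 <;> simp at h3 ⊢ <;> omega

end Commute

section Commute
variable {k : Type u} {A : Type v} [Field k] [NonUnitalCommRing A] [Module k A]
  {n q : ℕ}

/-- Exchanging the two distinct letters is a fixed-point-free involution. It reverses the sign and,
as `A` is commutative, keeps the contracted tuple. -/
theorem sum_contract_of_ne {m : ℕ} (f : Cochain k A n) (a : Fin (n + 1) → A) (j : Fin n) :
    ∑ w : Fin (n + 1) → Fin m with w j.castSucc ≠ w j.succ,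
      ((Equiv.Perm.sign (Tuple.sort w) : ℤ) : k) •
        f (Fin.contractNth j.castSucc (· * ·) (fun i => a ((Tuple.sort w)⁻¹ i))) = 0 := by
  refine Finset.sum_involution (fun w _ => w ∘ Equiv.swap j.castSucc j.succ) ?_ ?_ ?_ ?_
  · intro w hw
    have hw := (Finset.mem_filter.1 hw).2
    rw [contractNth_comp_sort_inv_swap w j hw, sort_comp_swap w j hw, Equiv.Perm.sign_mul,
      Equiv.Perm.sign_swap (Fin.castSucc_lt_succ).ne]
    simp
  · intro w hw _ h
    have hw := (Finset.mem_filter.1 hw).2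
    apply hw
    conv_lhs => rw [← h]
    simp
  · intro w hw
    have hw := (Finset.mem_filter.1 hw).2
    simpa using hw.symm
  · intro w hw
    funext i
    simp

/-- Words with a repeated letter at slot `j` arise from words of length `n` by doubling that letter.
Both copies have neighbouring ranks, so multiplying after the shuffle amounts to multiplying
neighbours of `a` before it, at the rank of `j`. The sign changes accordingly. -/
theorem sum_contract_of_eq {m : ℕ} (f : Cochain k A n) (a : Fin (n + 1) → A) (j : Fin n) :
    (-1 : k) ^ ((j : ℕ) + 1) • ∑ w : Fin (n + 1) → Fin m with w j.castSucc = w j.succ,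
      ((Equiv.Perm.sign (Tuple.sort w) : ℤ) : k) •
        f (Fin.contractNth j.castSucc (· * ·) (fun i => a ((Tuple.sort w)⁻¹ i)))
    = ∑ w : Fin n → Fin m, (-1 : k) ^ ((((Tuple.sort w)⁻¹ j : Fin n) : ℕ) + 1) •
        ((Equiv.Perm.sign (Tuple.sort w) : ℤ) : k) •
        f (fun l => Fin.contractNth ((Tuple.sort w)⁻¹ j).castSucc (· * ·) a
          ((Tuple.sort w)⁻¹ l)) := by
  rw [Finset.smul_sum]
  refine Finset.sum_nbij' (fun w => w ∘ j.succ.succAbove) (fun w => w ∘ j.predAbove) ?_ ?_ ?_ ?_ ?_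
  · intro w _; exact Finset.mem_univ _
  · intro w _; simp
  · intro w hw
    have hw := (Finset.mem_filter.1 hw).2
    funext i
    simp only [Function.comp_apply]
    by_cases h : i = j.succ
    · subst h
      rw [Fin.predAbove_succ_self, Fin.succAbove_of_castSucc_lt _ _ Fin.castSucc_lt_succ, hw]
    · rw [Fin.succ_succAbove_predAbove h]
  · intro w _
    funext i
    simp only [Function.comp_apply]
    congr 1
    rcases le_or_gt i j with h | h
    · rw [Fin.succAbove_of_castSucc_lt _ _ (Fin.castSucc_lt_succ_iff.2 h),
        Fin.predAbove_castSucc_of_le _ _ h]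
    · rw [Fin.succAbove_of_le_castSucc _ _ (Fin.succ_le_castSucc_iff.2 h),
        Fin.predAbove_succ_of_le _ _ h.le]
  · intro w hw
    have hw := (Finset.mem_filter.1 hw).2
    rw [contractNth_comp_sort_inv w j hw, sign_sort_succAbove w (sort_inv_succ_of_eq w j hw).2,
      smul_smul, smul_smul, ← mul_assoc, ← pow_add]
    congr 2
    rw [Fin.val_succ, Fin.val_succ]
    generalize (((Tuple.sort (w ∘ j.succ.succAbove))⁻¹ j : Fin n) : ℕ) = i
    rw [show (j : ℕ) + 1 + (i + 1 + ((j : ℕ) + 1)) = (i + 1) + 2 * ((j : ℕ) + 1) by ring,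
      pow_add _ _ (2 * _), pow_mul]
    simp

theorem sum_contract {m : ℕ} (f : Cochain k A n) (a : Fin (n + 1) → A) :
    ∑ w : Fin (n + 1) → Fin m, ((Equiv.Perm.sign (Tuple.sort w) : ℤ) : k) •
      ∑ j : Fin n, (-1 : k) ^ ((j : ℕ) + 1) •
        f (Fin.contractNth j.castSucc (· * ·) (fun i => a ((Tuple.sort w)⁻¹ i)))
    = ∑ i : Fin n, (-1 : k) ^ ((i : ℕ) + 1) •
        adamsOp k A n m f (Fin.contractNth i.castSucc (· * ·) a) := by
  simp only [adamsOp_apply, Finset.smul_sum]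
  rw [Finset.sum_comm]
  trans ∑ j : Fin n, ∑ w : Fin n → Fin m, (-1 : k) ^ ((((Tuple.sort w)⁻¹ j : Fin n) : ℕ) + 1) •
        ((Equiv.Perm.sign (Tuple.sort w) : ℤ) : k) •
        f (fun l => Fin.contractNth ((Tuple.sort w)⁻¹ j).castSucc (· * ·) a
          ((Tuple.sort w)⁻¹ l))
  · refine Finset.sum_congr rfl fun j _ => ?_
    rw [← sum_contract_of_eq, ← Finset.sum_filter_add_sum_filter_not Finset.univ
      (fun w : Fin (n + 1) → Fin m => w j.castSucc = w j.succ)]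
    simp only [smul_comm _ ((-1 : k) ^ ((j : ℕ) + 1)), ← Finset.smul_sum]
    rw [sum_contract_of_ne f a j, smul_zero, add_zero]
  · rw [Finset.sum_comm]
    conv_rhs => rw [Finset.sum_comm]
    refine Finset.sum_congr rfl fun w _ => ?_
    -- For a fixed word, the rank of `j` runs through all positions of `a` as `j` varies.
    exact Equiv.sum_comp (Tuple.sort w)⁻¹ (fun i : Fin n => (-1 : k) ^ ((i : ℕ) + 1) •
        ((Equiv.Perm.sign (Tuple.sort w) : ℤ) : k) •
        f (fun l => Fin.contractNth i.castSucc (· * ·) a ((Tuple.sort w)⁻¹ l)))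

variable [IsScalarTower k A A] [SMulCommClass k A A]

/-- The terms of `ψ (δ f)` in which the first or last argument is split off. -/
theorem sum_outer (f : Cochain k A n) (a : Fin (n + 1) → A) :
    ∑ w : Fin (n + 1) → Fin (q + 1), ((Equiv.Perm.sign (Tuple.sort w) : ℤ) : k) •
      (a ((Tuple.sort w)⁻¹ 0) * f (fun i => a ((Tuple.sort w)⁻¹ i.succ))) +
    (-1 : k) ^ (n + 1) • ∑ w : Fin (n + 1) → Fin (q + 1),
      ((Equiv.Perm.sign (Tuple.sort w) : ℤ) : k) •
      (f (fun i => a ((Tuple.sort w)⁻¹ i.castSucc)) * a ((Tuple.sort w)⁻¹ (Fin.last n)))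
    = a 0 * adamsOp k A n (q + 1) f (fun i => a i.succ)
      + (-1 : k) ^ (n + 1) •
        (adamsOp k A n (q + 1) f (fun i => a i.castSucc) * a (Fin.last n)) := by
  have hcons : ∀ F : (Fin (n + 1) → Fin (q + 1)) → A,
      ∑ w, F w = ∑ l : Fin (q + 1), ∑ u : Fin n → Fin (q + 1), F (Fin.cons l u) := fun F => by
    rw [← Fintype.sum_prod_type']
    exact (Equiv.sum_comp (Fin.consEquiv fun _ => Fin (q + 1)) F).symm
  have hsnoc : ∀ F : (Fin (n + 1) → Fin (q + 1)) → A,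
      ∑ w, F w = ∑ l : Fin (q + 1), ∑ u : Fin n → Fin (q + 1), F (Fin.snoc u l) := fun F => by
    rw [← Fintype.sum_prod_type']
    exact (Equiv.sum_comp (Fin.snocEquiv fun _ => Fin (q + 1)) F).symm
  -- Only the lowest first letter and the highest last letter survive: there the split-off entry is
  -- `a 0`, respectively the last entry of `a`.
  rw [hcons, hsnoc, Fin.sum_univ_succ, Fin.sum_univ_castSucc, adamsOp_apply, adamsOp_apply]
  have h0 : ∀ u : Fin n → Fin (q + 1),
      ((Equiv.Perm.sign (Tuple.sort (Fin.cons 0 u : Fin (n + 1) → Fin (q + 1))) : ℤ) : k) •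
        (a ((Tuple.sort (Fin.cons 0 u : Fin (n + 1) → Fin (q + 1)))⁻¹ 0) *
          f (fun i => a ((Tuple.sort (Fin.cons 0 u : Fin (n + 1) → Fin (q + 1)))⁻¹ i.succ)))
      = a 0 * ((Equiv.Perm.sign (Tuple.sort u) : ℤ) : k) •
          f (fun i => a ((Tuple.sort u)⁻¹ i).succ) := by
    intro u
    have hs := sign_sort_succAbove (Fin.cons 0 u) (sort_inv_cons_zero u) k
    have hc := comp_sort_inv_succAbove (Fin.cons 0 u) (sort_inv_cons_zero u) a
    simp only [Function.comp_def, Fin.cons_succ, Fin.zero_succAbove] at hs hc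
    simp only [sort_inv_cons_zero, hs, hc, mul_smul_comm]
    simp
  have hn : ∀ u : Fin n → Fin (q + 1),
      ((Equiv.Perm.sign (Tuple.sort (Fin.snoc u (Fin.last q) : Fin (n + 1) → Fin (q + 1))) : ℤ) : k)
        • (f (fun i => a ((Tuple.sort (Fin.snoc u (Fin.last q) : Fin (n + 1) → Fin (q + 1)))⁻¹
            i.castSucc)) *
          a ((Tuple.sort (Fin.snoc u (Fin.last q) : Fin (n + 1) → Fin (q + 1)))⁻¹ (Fin.last n)))
      = (((Equiv.Perm.sign (Tuple.sort u) : ℤ) : k) •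
          f (fun i => a ((Tuple.sort u)⁻¹ i).castSucc)) * a (Fin.last n) := by
    intro u
    have hs := sign_sort_succAbove (Fin.snoc u (Fin.last q)) (sort_inv_snoc_last u) k
    have hc := comp_sort_inv_succAbove (Fin.snoc u (Fin.last q)) (sort_inv_snoc_last u) a
    simp only [Function.comp_def, Fin.snoc_castSucc, Fin.succAbove_last] at hs hc
    simp only [sort_inv_snoc_last, hs, hc, smul_mul_assoc]
    simp [← two_mul]
  -- The first entry of pile `l + 1` dealt to the first slot is the last entry of pile `l` dealt to
  -- the last slot once the border between the piles is moved past it. The other slots are filled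
  -- alike, so by commutativity the two terms agree up to sign.
  have hmid : ∀ (l : Fin q) (u : Fin n → Fin (q + 1)),
      ((Equiv.Perm.sign (Tuple.sort (Fin.cons l.succ u : Fin (n + 1) → Fin (q + 1))) : ℤ) : k) •
        (a ((Tuple.sort (Fin.cons l.succ u : Fin (n + 1) → Fin (q + 1)))⁻¹ 0) *
          f (fun i => a ((Tuple.sort (Fin.cons l.succ u : Fin (n + 1) → Fin (q + 1)))⁻¹ i.succ)))
      = - ((-1 : k) ^ (n + 1) •
        ((Equiv.Perm.sign (Tuple.sort (Fin.snoc u l.castSucc : Fin (n + 1) → Fin (q + 1))) : ℤ) : k)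
        • (f (fun i => a ((Tuple.sort (Fin.snoc u l.castSucc : Fin (n + 1) → Fin (q + 1)))⁻¹
            i.castSucc)) *
          a ((Tuple.sort (Fin.snoc u l.castSucc : Fin (n + 1) → Fin (q + 1)))⁻¹
            (Fin.last n)))) := by
    intro l u
    obtain ⟨i, hi⟩ : ∃ i, (Tuple.sort (Fin.cons l.succ u : Fin (n + 1) → Fin (q + 1)))⁻¹ 0 = i :=
      ⟨_, rfl⟩
    have hi' : (Tuple.sort (Fin.snoc u l.castSucc : Fin (n + 1) → Fin (q + 1)))⁻¹ (Fin.last n)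
        = i := by
      apply Fin.ext
      rw [sort_inv_snoc, ← hi, sort_inv_cons_succ]
    have hs := sign_sort_succAbove _ hi k
    have hc := comp_sort_inv_succAbove _ hi a
    have hs' := sign_sort_succAbove _ hi' k
    have hc' := comp_sort_inv_succAbove _ hi' a
    simp only [Function.comp_def, Fin.snoc_castSucc, Fin.succAbove_last] at hs' hc'
    simp only [Function.comp_def, Fin.cons_succ, Fin.zero_succAbove] at hs hc
    simp only [hs, hc, hs', hc', hi, hi', mul_comm (a i), smul_smul, ← neg_smul]
    congr 1
    rw [← mul_assoc, ← pow_add, ← neg_mul]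
    congr 1
    rw [Fin.val_zero, Fin.val_last, show n + 1 + ((i : ℕ) + n) = ((i : ℕ) + 0) + 1 + 2 * n by ring,
      pow_add _ _ (2 * n), pow_succ, pow_mul]
    simp
  simp only [h0, hn, hmid, Finset.mul_sum, Finset.sum_mul, smul_add, Finset.smul_sum,
    Finset.sum_neg_distrib]
  abel

/-- Valid for every Hochschild cochain of a commutative algebra, coherent or not. The number of
letters is `q + 1` because lowest and highest letters must exist. -/
theorem coboundary_adamsOp (f : Cochain k A n) :
    coboundary k A n (adamsOp k A n (q + 1) f)
      = adamsOp k A (n + 1) (q + 1) (coboundary k A n f) := by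
  ext a
  have hcob : ∀ {n : ℕ} (g : Cochain k A n) (a), coboundary k A n g a = coboundaryFun g a :=
    fun g a => rfl
  rw [adamsOp_apply, hcob]
  simp only [hcob, coboundaryFun, smul_add, Finset.sum_add_distrib]
  rw [sum_contract]
  have := sum_outer (q := q) f a
  simp only [Finset.smul_sum, smul_comm ((-1 : k) ^ (n + 1))] at this ⊢
  rw [add_right_comm, add_right_comm (Finset.sum _ _), this]

end Commute

/-! ### The square of the coboundary vanishes -/

theorem alternating_double_sum {k M : Type*} [Ring k] [AddCommGroup M] [Module k M] {n : ℕ}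
    (G : Fin (n + 3) → Fin (n + 2) → M)
    (hG : ∀ i j : Fin (n + 2), i ≤ j → G j.succ i = G i.castSucc j) :
    ∑ j : Fin (n + 3), ∑ i : Fin (n + 2), (-1 : k) ^ ((j : ℕ) + i) • G j i = 0 := by
  rw [← Fintype.sum_prod_type'
      (f := fun (j : Fin (n + 3)) (i : Fin (n + 2)) => (-1 : k) ^ ((j : ℕ) + (i : ℕ)) • G j i),
    ← Finset.sum_filter_add_sum_filter_not Finset.univ
      (fun x : Fin (n + 3) × Fin (n + 2) => (x.2 : ℕ) < x.1), add_eq_zero_iff_eq_neg,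
    ← Finset.sum_neg_distrib]
  -- The pair `(j, i)` with `i < j` cancels against `(i, j - 1)`, whose index sum has the opposite
  -- parity.
  refine Finset.sum_bij' (fun x hx => (x.2.castSucc, x.1.pred ?_))
    (fun x hx => (x.2.succ, x.1.castLT ?_)) ?_ ?_ ?_ ?_ ?_
  · have := (Finset.mem_filter.1 hx).2
    rintro h
    rw [h] at this
    simp at this
  · have := (Finset.mem_filter.1 hx).2
    have := x.2.2
    omega
  · intro x hx
    have := (Finset.mem_filter.1 hx).2
    simp only [Finset.mem_filter, Finset.mem_univ, true_and, Fin.val_pred, Fin.val_castSucc]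
    omega
  · intro x hx
    have := (Finset.mem_filter.1 hx).2
    simp only [Finset.mem_filter, Finset.mem_univ, true_and, Fin.val_succ, Fin.val_castLT]
    omega
  · intro x hx; simp
  · intro x hx; simp
  · rintro ⟨j, i⟩ hx
    have hx := (Finset.mem_filter.1 hx).2
    obtain ⟨j, rfl⟩ := Fin.exists_succ_eq.2 (show j ≠ 0 by rintro rfl; simp at hx)
    simp only [Fin.val_succ, Fin.pred_succ, Fin.val_castSucc] at hx ⊢
    rw [hG i j (Fin.le_def.2 (by omega)), ← neg_smul]
    congr 1
    rw [show (j : ℕ) + 1 + i = i + j + 1 by ring, pow_succ]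
    simp

section Coboundary

variable {k : Type u} {A : Type v} [Field k] [NonUnitalRing A] [Module k A] {n : ℕ}

/-- The terms of the Hochschild coboundary. -/
def coface (i : Fin (n + 2)) (f : (Fin n → A) → A) (a : Fin (n + 1) → A) : A :=
  Fin.cases (a 0 * f (fun i => a i.succ)) (fun j => Fin.lastCases
    (f (fun i => a i.castSucc) * a (Fin.last n))
    (fun j => f (Fin.contractNth j.castSucc (· * ·) a)) j) i

theorem coface_zero (f : (Fin n → A) → A) (a : Fin (n + 1) → A) :
    coface 0 f a = a 0 * f (fun i => a i.succ) := rfl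

theorem coface_last (f : (Fin n → A) → A) (a : Fin (n + 1) → A) :
    coface (Fin.last n).succ f a = f (fun i => a i.castSucc) * a (Fin.last n) := by
  rw [coface, Fin.cases_succ, Fin.lastCases_last]

theorem coface_mid (j : Fin n) (f : (Fin n → A) → A) (a : Fin (n + 1) → A) :
    coface j.castSucc.succ f a = f (Fin.contractNth j.castSucc (· * ·) a) := by
  simp [coface]

theorem coboundaryFun_eq_sum (f : Cochain k A n) (a : Fin (n + 1) → A) :
    coboundaryFun f a = ∑ i : Fin (n + 2), (-1 : k) ^ (i : ℕ) • coface i f a := by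
  rw [Fin.sum_univ_succ, Fin.sum_univ_castSucc]
  simp only [coface_zero, coface_last, coface_mid, coboundaryFun, Fin.val_succ, Fin.val_castSucc,
    Fin.val_last, Fin.val_zero, pow_zero, one_smul, add_assoc]

theorem contractNth_contractNth {i j : Fin n} (hij : i ≤ j) (a : Fin (n + 2) → A) :
    Fin.contractNth i.castSucc (· * ·) (Fin.contractNth j.succ.castSucc (· * ·) a)
      = Fin.contractNth j.castSucc (· * ·) (Fin.contractNth i.castSucc.castSucc (· * ·) a) := by
  have hij := Fin.le_def.1 hij
  funext l
  simp only [Fin.contractNth, Fin.val_castSucc, Fin.val_succ]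
  split_ifs <;> first | rfl | omega | (simp only [mul_assoc]; rfl)

/-- The cosimplicial identities. The cases with `i = j` use associativity; the others hold because
the two operations touch disjoint places. -/
theorem coface_coface {i j : Fin (n + 2)} (hij : i ≤ j) (f : (Fin n → A) → A) :
    coface j.succ (coface i f) = coface i.castSucc (coface j f) := by
  funext a
  induction i using Fin.cases with
  | zero =>
    rw [Fin.castSucc_zero]
    induction j using Fin.cases with
    | zero =>
      change coface (Fin.castSucc 0).succ _ _ = _
      rw [coface_mid, coface_zero, coface_zero, coface_zero]
      simp [Fin.contractNth, mul_assoc]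
    | succ j =>
      induction j using Fin.lastCases with
      | last =>
        change coface (Fin.last (n + 1)).succ _ _ = _
        rw [coface_last, coface_zero, coface_zero, coface_last, mul_assoc]
        rfl
      | cast j =>
        change coface j.succ.castSucc.succ _ _ = _
        rw [coface_mid, coface_zero, coface_zero, coface_mid]
        have h0 : Fin.contractNth j.succ.castSucc (· * ·) a 0 = a 0 := by simp [Fin.contractNth]
        rw [h0]
        congr 2
        funext l
        simp only [Fin.contractNth, Fin.val_castSucc, Fin.val_succ, add_lt_add_iff_right,
          add_left_inj]
        rfl
  | succ i =>
    obtain ⟨j, rfl⟩ := Fin.exists_succ_eq.2 (show j ≠ 0 by rintro rfl; simp at hij)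
    have hij := Fin.succ_le_succ_iff.1 hij
    induction i using Fin.lastCases with
    | last =>
      obtain rfl := Fin.last_le_iff.1 hij
      change coface (Fin.last (n + 1)).succ _ _ = coface (Fin.last n).castSucc.succ _ _
      rw [coface_last, coface_last, coface_mid, coface_last]
      have h : Fin.contractNth (Fin.last n).castSucc (· * ·) a (Fin.last n)
          = a (Fin.last n).castSucc * a (Fin.last (n + 1)) := by
        rw [Fin.contractNth_apply_of_eq _ _ _ _ rfl, Fin.succ_last]
      rw [h, mul_assoc]
      congr 2
      funext l
      rw [Fin.contractNth_apply_of_lt _ _ _ _ (by simp)]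
    | cast i =>
      induction j using Fin.lastCases with
      | last =>
        change coface (Fin.last (n + 1)).succ _ _ = coface i.castSucc.castSucc.succ _ _
        rw [coface_last, coface_mid, coface_mid, coface_last]
        have h : Fin.contractNth i.castSucc.castSucc (· * ·) a (Fin.last n)
            = a (Fin.last (n + 1)) := by
          rw [Fin.contractNth_apply_of_gt _ _ _ _ (by simp), Fin.succ_last]
        rw [h]
        rfl
      | cast j =>
        change coface j.succ.castSucc.succ _ _ = coface i.castSucc.castSucc.succ _ _
        rw [coface_mid, coface_mid, coface_mid, coface_mid,
          contractNth_contractNth (Fin.castSucc_le_castSucc_iff.1 hij)]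

variable [IsScalarTower k A A] [SMulCommClass k A A]

theorem coboundary_coboundary (f : Cochain k A n) :
    coboundary k A (n + 1) (coboundary k A n f) = 0 := by
  ext a
  have hcob : ∀ {n : ℕ} (g : Cochain k A n), ⇑(coboundary k A n g)
      = fun a => ∑ i : Fin (n + 2), (-1 : k) ^ (i : ℕ) • coface i g a :=
    fun g => funext fun a => coboundaryFun_eq_sum g a
  have hlin : ∀ (j : Fin (n + 3)), coface j (coboundary k A n f) a
      = ∑ i : Fin (n + 2), (-1 : k) ^ (i : ℕ) • coface j (coface i f) a := by
    intro j
    rw [hcob]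
    induction j using Fin.cases with
    | zero => simp only [coface_zero, Finset.mul_sum, mul_smul_comm]
    | succ j =>
      induction j using Fin.lastCases with
      | last => simp only [coface_last, Finset.sum_mul, smul_mul_assoc]
      | cast j => simp only [coface_mid]
  rw [hcob]
  simp only [hlin, Finset.smul_sum, smul_smul, ← pow_add]
  exact alternating_double_sum (k := k) (fun j i => coface j (coface i f) a)
    fun i j hij => congrFun (coface_coface hij f) a

end Coboundary

/-! ### Stability of the coherent cochains -/

section Coherence

variable {k : Type u} {A : Type v} [Field k] [NonUnitalRing A] [Module k A]
  {S : Type w} [CommSemigroup S] (ι : S →ₙ* A)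

/-- Adjoining a unit makes `S` a commutative monoid, where finite products and their permutation
invariance are at hand. -/
theorem coe_seqProd : ∀ (n : ℕ) (s : Fin (n + 1) → S),
    ((seqProd n s : S) : WithOne S) = ∏ i, (s i : WithOne S)
  | 0, s => by simp [seqProd]
  | n + 1, s => by
    rw [seqProd, WithOne.coe_mul, coe_seqProd n, Fin.prod_univ_castSucc (n := n + 1)]

theorem seqProd_perm (n : ℕ) (s : Fin (n + 1) → S) (σ : Equiv.Perm (Fin (n + 1))) :
    seqProd n (fun i => s (σ i)) = seqProd n s := by
  apply WithOne.coe_injective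
  rw [coe_seqProd, coe_seqProd]
  exact Equiv.prod_comp σ fun i => (s i : WithOne S)

theorem seqProd_succ' (n : ℕ) (s : Fin (n + 2) → S) :
    s 0 * seqProd n (fun i => s i.succ) = seqProd (n + 1) s := by
  apply WithOne.coe_injective
  rw [WithOne.coe_mul, coe_seqProd, coe_seqProd, Fin.prod_univ_succ (n := n + 1)]

theorem seqProd_contractNth (n : ℕ) (s : Fin (n + 2) → S) (j : Fin (n + 1)) :
    seqProd n (Fin.contractNth j.castSucc (· * ·) s) = seqProd (n + 1) s := by
  apply WithOne.coe_injective
  rw [coe_seqProd, coe_seqProd]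
  have hp : ∀ {m : ℕ} (g : Fin m → WithOne S), ∏ i, g i = Fin.partialProd g (Fin.last m) := by
    intro m g
    rw [Fin.partialProd, Fin.val_last, List.take_of_length_le (by simp), List.prod_ofFn]
  have h := Fin.comp_contractNth (· * ·) (· * ·) (f := ((↑) : S → WithOne S))
    (fun _ _ => WithOne.coe_mul _ _) j.castSucc s
  rw [hp, hp]
  change Fin.partialProd (((↑) : S → WithOne S) ∘ _) _ = _
  rw [h, Fin.partialProd_contractNth, Function.comp_apply, ← Fin.succ_last,
    Fin.succAbove_of_le_castSucc _ _ (by simp [Fin.le_def]; omega)]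
  rfl

theorem domDomCongr_mem_coherent (n : ℕ) {f : Cochain k A n} (hf : f ∈ coherent ι n)
    (σ : Equiv.Perm (Fin n)) : f.domDomCongr σ ∈ coherent ι n := by
  cases n with
  | zero =>
    obtain rfl : f = 0 := hf
    exact Submodule.zero_mem _
  | succ n =>
    intro s
    obtain ⟨c, hc⟩ := hf (fun i => s (σ i))
    exact ⟨c, by rw [MultilinearMap.domDomCongr_apply, hc, seqProd_perm]⟩

variable [IsScalarTower k A A] [SMulCommClass k A A]

theorem coboundary_mem_coherent (n : ℕ) {f : Cochain k A n} (hf : f ∈ coherent ι n) :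
    coboundary k A n f ∈ coherent ι (n + 1) := by
  cases n with
  | zero =>
    obtain rfl : f = 0 := hf
    rw [map_zero]
    exact Submodule.zero_mem _
  | succ n =>
    intro s
    obtain ⟨c, hc⟩ := hf (fun i => s i.succ)
    obtain ⟨d, hd⟩ := hf (fun i => s i.castSucc)
    have hmid : ∀ j : Fin (n + 1), ∃ c : k, f (Fin.contractNth j.castSucc (· * ·) fun i => ι (s i))
        = c • ι (seqProd (n + 1) s) := by
      intro j
      obtain ⟨c, hc⟩ := hf (Fin.contractNth j.castSucc (· * ·) s)
      refine ⟨c, ?_⟩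
      rw [← seqProd_contractNth n s j, ← hc]
      congr 1
      exact (Fin.comp_contractNth (· * ·) (· * ·) (f := ι) (map_mul ι) j.castSucc s).symm
    choose e he using hmid
    refine ⟨c + ∑ j : Fin (n + 1), (-1) ^ ((j : ℕ) + 1) * e j + (-1) ^ (n + 1 + 1) * d, ?_⟩
    change coboundaryFun f (fun i => ι (s i)) = _
    simp only [coboundaryFun, hc, hd, he, mul_smul_comm, smul_mul_assoc, ← map_mul, seqProd_succ',
      add_smul, Finset.sum_smul, mul_smul]
    rfl

end Coherence

/-! ### Counting words, and orthogonality in the rational group ring -/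

section Counting

/-- Read along `σ`, the word must increase weakly, and strictly at the descents of `σ`, since
stability forbids a tie there. -/
theorem sort_eq_iff_step {n m : ℕ} (w : Fin (n + 1) → Fin m) (σ : Equiv.Perm (Fin (n + 1))) :
    Tuple.sort w = σ ↔ ∀ i : Fin n, (w (σ i.castSucc) : ℕ) +
      (if σ i.succ < σ i.castSucc then 1 else 0) ≤ w (σ i.succ) := by
  have hne : ∀ i : Fin n, σ i.succ ≠ σ i.castSucc := fun i h =>
    (Fin.castSucc_lt_succ (i := i)).ne' (σ.injective h)
  rw [eq_comm, Tuple.eq_sort_iff]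
  constructor
  · rintro ⟨h1, h2⟩ i
    have h3 : w (σ i.castSucc) ≤ w (σ i.succ) := h1 (Fin.castSucc_lt_succ (i := i)).le
    have h4 := h2 _ _ (Fin.castSucc_lt_succ (i := i))
    split_ifs with h
    · rcases h3.lt_or_eq with h5 | h5
      · exact h5
      · exact absurd (h4 h5) h.asymm
    · exact h3
  · intro h
    have hmono : StrictMono fun i => toLex (w (σ i), σ i) := by
      refine Fin.strictMono_iff_lt_succ.2 fun i => ?_
      rw [Prod.Lex.toLex_lt_toLex]
      have := h i
      split_ifs at this with h'
      · exact Or.inl this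
      · rcases (Fin.le_def.2 this : w (σ i.castSucc) ≤ w (σ i.succ)).lt_or_eq with h5 | h5
        · exact Or.inl h5
        · exact Or.inr ⟨h5, lt_of_le_of_ne (not_lt.1 h') (hne i).symm⟩
    constructor
    · intro i j hij
      have := hmono.monotone hij
      rw [Prod.Lex.toLex_le_toLex] at this
      exact this.elim le_of_lt fun h => h.1.le
    · intro i j hij he
      have := hmono hij
      rw [Prod.Lex.toLex_lt_toLex] at this
      exact this.elim (fun h => absurd he h.ne) fun h => h.2

theorem card_filter_strictMono (n N : ℕ) :
    (Finset.univ.filter fun c : Fin n → Fin N => StrictMono c).card = N.choose n := by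
  rw [← Fintype.card_subtype]
  let e : {c : Fin n → Fin N // StrictMono c} ≃ (Fin n ↪o Fin N) :=
    { toFun := fun c => OrderEmbedding.ofStrictMono c.1 c.2
      invFun := fun c => ⟨c, c.strictMono⟩
      left_inv := fun _ => rfl
      right_inv := fun _ => by ext; rfl }
  rw [← Nat.card_eq_fintype_card, Nat.card_congr (e.trans Set.powersetCard.ofFinEmbEquiv),
    Set.powersetCard.card, Nat.card_eq_fintype_card, Fintype.card_fin]

theorem descents_eq {n : ℕ} (σ : Equiv.Perm (Fin (n + 1))) :
    descents σ = (Finset.univ.filter fun i : Fin n => σ i.succ < σ i.castSucc).card := by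
  have : (Finset.univ.filter fun i : Fin (n + 1) => ∃ h : (i : ℕ) + 1 < n + 1,
      σ ⟨i + 1, h⟩ < σ i)
      = (Finset.univ.filter fun i : Fin n => σ i.succ < σ i.castSucc).map Fin.castSuccEmb := by
    ext t
    induction t using Fin.lastCases with
    | last => simp
    | cast t => simp [Fin.succ]
  rw [descents, this, Finset.card_map]

/-- The number of words of length `n + 1` in `m` letters that are sorted by `σ`. -/
theorem card_sort_eq {n m : ℕ} (hm : 0 < m) (σ : Equiv.Perm (Fin (n + 1))) :
    (Finset.univ.filter fun w : Fin (n + 1) → Fin m => Tuple.sort w = σ).card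
      = (m + n - descents σ).choose (n + 1) := by
  -- `E i` counts the non-descents before `i`. Adding it to `w ∘ σ` makes the weak steps strict, and
  -- its final value `n - des σ` enlarges the range to `m + n - des σ`, so one counts strictly
  -- increasing sequences.
  obtain ⟨E, hE⟩ : ∃ E : Fin (n + 1) → ℕ, ∀ i, E i = (Finset.univ.filter fun j : Fin n =>
      j.castSucc < i ∧ ¬ σ j.succ < σ j.castSucc).card := ⟨_, fun _ => rfl⟩
  have hE0 : E 0 = 0 := by simp [hE]
  have hEl : E (Fin.last n) + descents σ = n := by
    have := Finset.card_filter_add_card_filter_not (s := (Finset.univ : Finset (Fin n)))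
      (fun j => σ j.succ < σ j.castSucc)
    rw [Finset.card_univ, Fintype.card_fin] at this
    rw [descents_eq, hE, add_comm]
    simpa [Fin.castSucc_lt_last] using this
  have hEs : ∀ i : Fin n, E i.succ + (if σ i.succ < σ i.castSucc then 1 else 0)
      = E i.castSucc + 1 := by
    intro i
    have hsub : ∀ j : Fin n, j.castSucc < i.succ ↔ j = i ∨ j.castSucc < i.castSucc := by
      intro j
      simp only [Fin.lt_def, Fin.ext_iff, Fin.val_castSucc, Fin.val_succ]
      omega
    split_ifs with h
    · rw [hE, hE]
      congr 2
      refine Finset.filter_congr fun j _ => ?_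
      rw [hsub]
      constructor
      · rintro ⟨rfl | h1, h2⟩
        · exact absurd h h2
        · exact ⟨h1, h2⟩
      · exact fun h' => ⟨Or.inr h'.1, h'.2⟩
    · rw [hE, hE, add_zero, ← Finset.card_insert_of_notMem (a := i) (by simp)]
      congr 1
      ext j
      simp only [Finset.mem_filter, Finset.mem_univ, true_and, Finset.mem_insert, hsub]
      constructor
      · rintro ⟨h1 | h1, h2⟩
        · exact Or.inl h1
        · exact Or.inr ⟨h1, h2⟩
      · rintro (rfl | h')
        · exact ⟨Or.inl rfl, h⟩
        · exact ⟨Or.inr h'.1, h'.2⟩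
  have hEmono : Monotone E := Fin.monotone_iff_le_succ.2 fun i => by
    have := hEs i
    split_ifs at this <;> omega
  rw [← card_filter_strictMono]
  have hwmono : ∀ w : Fin (n + 1) → Fin m, Tuple.sort w = σ → Monotone (w ∘ σ) := fun w hw =>
    hw ▸ Tuple.monotone_sort w
  have hle : ∀ c : Fin (n + 1) → Fin (m + n - descents σ), StrictMono c → ∀ i, E i ≤ c i := by
    intro c hc i
    induction i using Fin.induction with
    | zero => simp [hE0]
    | succ i ih =>
      have h1 := hEs i
      have h2 : (c i.castSucc : ℕ) < c i.succ := hc (Fin.castSucc_lt_succ (i := i))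
      omega
  have hcmono : ∀ c : Fin (n + 1) → Fin (m + n - descents σ), StrictMono c →
      Monotone fun i => (c i : ℕ) - E i := by
    intro c hc
    refine Fin.monotone_iff_le_succ.2 fun i => ?_
    have h1 := hEs i
    have h2 : (c i.castSucc : ℕ) < c i.succ := hc (Fin.castSucc_lt_succ (i := i))
    have h3 := hle c hc i.castSucc
    have h4 := hle c hc i.succ
    omega
  refine Finset.card_bij' (fun w hw i => ⟨w (σ i) + E i, ?_⟩)
    (fun c hc j => ⟨c (σ⁻¹ j) - E (σ⁻¹ j), ?_⟩) ?_ ?_ ?_ ?_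
  · have hw := (Finset.mem_filter.1 hw).2
    have h1 : (w (σ i) : ℕ) ≤ w (σ (Fin.last n)) := hwmono w hw (Fin.le_last i)
    have h2 := hEmono (Fin.le_last i)
    have h3 := (w (σ (Fin.last n))).2
    omega
  · have hc := (Finset.mem_filter.1 hc).2
    have h1 := hcmono c hc (Fin.le_last (σ⁻¹ j))
    have h2 := (c (Fin.last n)).2
    dsimp only at h1
    omega
  · intro w hw
    have hw := (Finset.mem_filter.1 hw).2
    refine Finset.mem_filter.2 ⟨Finset.mem_univ _, Fin.strictMono_iff_lt_succ.2 fun i => ?_⟩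
    have h1 := (sort_eq_iff_step w σ).1 hw i
    have h2 := hEs i
    rw [Fin.lt_def]
    dsimp only
    omega
  · intro c hc
    have hc := (Finset.mem_filter.1 hc).2
    refine Finset.mem_filter.2 ⟨Finset.mem_univ _, (sort_eq_iff_step _ σ).2 fun i => ?_⟩
    have h1 := hEs i
    have h2 : (c i.castSucc : ℕ) < c i.succ := hc (Fin.castSucc_lt_succ (i := i))
    have h3 := hle c hc i.castSucc
    have h4 := hle c hc i.succ
    simp only [Equiv.Perm.inv_def, Equiv.symm_apply_apply]
    omega
  · intro w hw
    funext j
    simp [Equiv.Perm.inv_def]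
  · intro c hc
    have hc := (Finset.mem_filter.1 hc).2
    funext i
    apply Fin.ext
    have := hle c hc i
    simp only [Equiv.Perm.inv_def, Equiv.symm_apply_apply]
    omega

theorem descents_le {n : ℕ} (σ : Equiv.Perm (Fin (n + 1))) : descents σ ≤ n := by
  rw [descents_eq]
  exact (Finset.card_filter_le _ _).trans (by simp)

open Polynomial

theorem binomPoly_eval {n d m : ℕ} (hd : d ≤ n) :
    (binomPoly (n + 1) d).eval (m : ℚ) = ((m + n - d).choose (n + 1) : ℚ) := by
  have h1 := descPochhammer_eval_eq_prod_range (n + 1) ((m + n - d : ℕ) : ℚ)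
  rw [descPochhammer_eval_eq_descFactorial, Nat.descFactorial_eq_factorial_mul_choose] at h1
  rw [binomPoly, eval_mul, eval_C, eval_prod]
  have h2 : ∀ l ∈ Finset.range (n + 1), (X + C (((n + 1 : ℕ) : ℚ) - 1 - d - l)).eval (m : ℚ)
      = ((m + n - d : ℕ) : ℚ) - l := by
    intro l _
    rw [Nat.cast_sub (by omega)]
    simp
    ring
  rw [Finset.prod_congr rfl h2, ← h1]
  have := Nat.cast_ne_zero (R := ℚ).2 (n + 1).factorial_ne_zero
  push_cast
  field_simp

theorem binomPoly_natDegree_le (n d : ℕ) : (binomPoly n d).natDegree ≤ n := by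
  rw [binomPoly]
  refine (natDegree_C_mul_le _ _).trans ((natDegree_prod_le _ _).trans ?_)
  refine (Finset.sum_le_sum fun l _ => natDegree_X_add_C _ |>.le).trans (by simp)

/-- In positive degree there is no idempotent of index `0`, because no word has letters from an
empty alphabet. -/
theorem binomPoly_coeff_zero {n d : ℕ} (hd : d ≤ n) : (binomPoly (n + 1) d).coeff 0 = 0 := by
  rw [coeff_zero_eq_eval_zero]
  have := binomPoly_eval (m := 0) hd
  rw [Nat.cast_zero] at this
  rw [this, Nat.choose_eq_zero_of_lt (by omega), Nat.cast_zero]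

theorem binomPoly_eval_eq_sum {n d : ℕ} (hd : d ≤ n) (x : ℚ) :
    (binomPoly (n + 1) d).eval x
      = ∑ j ∈ Finset.Icc 1 (n + 1), x ^ j * (binomPoly (n + 1) d).coeff j := by
  rw [eval_eq_sum_range' (Nat.lt_succ_of_le (binomPoly_natDegree_le _ _)),
    Finset.range_eq_Ico, Finset.sum_eq_sum_Ico_succ_bot (by omega), binomPoly_coeff_zero hd,
    zero_mul, zero_add]
  exact Finset.sum_congr (by ext; simp) fun j _ => mul_comm _ _

theorem eulerianCoeff_of_lt {n i : ℕ} (h : n < i) (σ : Equiv.Perm (Fin n)) :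
    eulerianCoeff n i σ = 0 := by
  rw [eulerianCoeff, coeff_eq_zero_of_natDegree_lt ((binomPoly_natDegree_le _ _).trans_lt h),
    mul_zero]

/-- The coefficient of `σ` in `ψᵐ`. -/
def wordCoeff (n m : ℕ) (σ : Equiv.Perm (Fin n)) : ℤ :=
  Equiv.Perm.sign σ * (Finset.univ.filter fun w : Fin n → Fin m => Tuple.sort w = σ).card

theorem wordCoeff_eq_sum {n : ℕ} (m : ℕ) (σ : Equiv.Perm (Fin n)) :
    wordCoeff n m σ = ∑ w : Fin n → Fin m,
      if Tuple.sort w = σ then (Equiv.Perm.sign σ : ℤ) else 0 := by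
  rw [wordCoeff, ← Finset.sum_filter, Finset.sum_const, nsmul_eq_mul, mul_comm]

/-- The eigenvalue expansion `ψᵐ = ∑ mʲ eₙ⁽ʲ⁾`, the link between the combinatorics of words and the
idempotents. -/
theorem wordCoeff_eq {n m : ℕ} (hm : 0 < m) (σ : Equiv.Perm (Fin (n + 1))) :
    (wordCoeff (n + 1) m σ : ℚ)
      = ∑ j ∈ Finset.Icc 1 (n + 1), (m : ℚ) ^ j * eulerianCoeff (n + 1) j σ := by
  have := binomPoly_eval_eq_sum (descents_le σ) m
  rw [binomPoly_eval (descents_le σ), ← card_sort_eq hm] at this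
  simp only [wordCoeff, eulerianCoeff, Int.cast_mul, Int.cast_natCast, this, Finset.mul_sum]
  exact Finset.sum_congr rfl fun j _ => mul_left_comm _ _ _

/-- The product of the group ring `R[Sₙ]`, in terms of coefficients. -/
def conv {R : Type*} [CommRing R] {n : ℕ} (x y : Equiv.Perm (Fin n) → R)
    (ρ : Equiv.Perm (Fin n)) : R :=
  ∑ σ, x σ * y (σ⁻¹ * ρ)

theorem conv_wordCoeff (n a b : ℕ) (ρ : Equiv.Perm (Fin n)) :
    conv (wordCoeff n a) (wordCoeff n b) ρ = wordCoeff n (b * a) ρ := by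
  let e : (Fin b ×ₗ Fin a) ≃o Fin (b * a) := (Fintype.orderIsoFinOfCardEq _ (by
    rw [Fintype.card_congr (ofLex : (Fin b ×ₗ Fin a) ≃ Fin b × Fin a), Fintype.card_prod,
      Fintype.card_fin, Fintype.card_fin])).symm
  have hw := @wordCoeff_eq_sum n
  -- A pair of words becomes one word in pairs of letters. The second word is read at the ranks of
  -- the first, so that the composite of the two sorts is a single lexicographic sort.
  let E : (Fin n → Fin a) × (Fin n → Fin b) → (Fin n → Fin (b * a)) := fun x i =>
    e (toLex (x.2 ((Tuple.sort x.1)⁻¹ i), x.1 i))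
  have hE : Function.Bijective E := by
    constructor
    · rintro ⟨w, v⟩ ⟨w', v'⟩ h
      have h1 : ∀ i, v ((Tuple.sort w)⁻¹ i) = v' ((Tuple.sort w')⁻¹ i) ∧ w i = w' i := fun i => by
        simpa using e.injective (congrFun h i)
      obtain rfl : w = w' := funext fun i => (h1 i).2
      refine Prod.ext rfl (funext fun i => ?_)
      simpa [Equiv.Perm.inv_def] using (h1 (Tuple.sort w i)).1
    · intro u
      refine ⟨(fun i => (ofLex (e.symm (u i))).2, fun i => (ofLex (e.symm (u (Tuple.sort
        (fun i => (ofLex (e.symm (u i))).2) i)))).1), ?_⟩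
      funext i
      simp [E, Equiv.Perm.inv_def]
  have hsort : ∀ x, Tuple.sort (E x) = Tuple.sort x.1 * Tuple.sort x.2 := fun x => by
    rw [← sort_toLex]
    exact sort_orderIso_comp e _
  rw [hw, ← Equiv.sum_comp (Equiv.ofBijective E hE), Fintype.sum_prod_type]
  simp only [Equiv.ofBijective_apply, hsort, conv, hw, Finset.sum_mul_sum]
  rw [Finset.sum_comm]
  refine Finset.sum_congr rfl fun w _ => ?_
  rw [Finset.sum_comm]
  refine Finset.sum_congr rfl fun v _ => ?_
  rw [Finset.sum_eq_single (Tuple.sort w)]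
  · rw [if_pos rfl]
    by_cases h : Tuple.sort w * Tuple.sort v = ρ
    · subst h
      simp
    · rw [if_neg h, if_neg, mul_zero]
      rintro h'
      exact h (by rw [h']; simp)
  · intro σ _ hσ
    rw [if_neg hσ.symm, zero_mul]
  · simp

theorem wordCoeff_one (n : ℕ) (σ : Equiv.Perm (Fin n)) :
    wordCoeff n 1 σ = if σ = 1 then 1 else 0 := by
  have h : ∀ w : Fin n → Fin 1, Tuple.sort w = 1 := fun w =>
    Tuple.sort_eq_refl_iff_monotone.2 fun i j _ => (Subsingleton.elim _ _).le
  simp only [wordCoeff, h]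
  by_cases hσ : σ = 1
  · subst hσ; simp
  · simp [hσ, Ne.symm hσ]

/-- After applying a linear functional this is a polynomial vanishing at all positive integers. It
serves to compare coefficients of powers of `m` in identities between Adams operations. -/
theorem eq_zero_of_sum_pow_smul_eq_zero {K V : Type*} [Field K] [CharZero K] [AddCommGroup V]
    [Module K V] (s : Finset ℕ) (v : ℕ → V)
    (h : ∀ m : ℕ, 0 < m → ∑ j ∈ s, (m : K) ^ j • v j = 0) : ∀ j ∈ s, v j = 0 := by
  intro j hj
  rw [← Module.forall_dual_apply_eq_zero_iff K]
  intro φ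
  have hp : (∑ j ∈ s, C (φ (v j)) * X ^ j : K[X]) = 0 := by
    refine Polynomial.eq_zero_of_infinite_isRoot _ (Set.Infinite.mono ?_
      (Set.infinite_range_of_injective
        (f := fun m : ℕ => ((m + 1 : ℕ) : K)) fun a b hab => by simpa using hab))
    rintro _ ⟨m, rfl⟩
    have := congrArg φ (h (m + 1) m.succ_pos)
    simp only [map_sum, map_smul, map_zero, smul_eq_mul] at this
    simp only [Set.mem_ofPred_eq, IsRoot, eval_finsetSum, eval_mul, eval_C, eval_pow, eval_X]
    rw [← this]
    exact Finset.sum_congr rfl fun j _ => mul_comm _ _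
  have := congrArg (fun p => p.coeff j) hp
  simpa [finsetSum_coeff, coeff_C_mul, coeff_X_pow, hj] using this

theorem conv_sum_left {R ι : Type*} [CommRing R] {n : ℕ} (s : Finset ι)
    (x : ι → Equiv.Perm (Fin n) → R) (y : Equiv.Perm (Fin n) → R) (ρ) :
    conv (fun σ => ∑ i ∈ s, x i σ) y ρ = ∑ i ∈ s, conv (x i) y ρ := by
  simp only [conv, Finset.sum_mul]
  exact Finset.sum_comm

theorem conv_sum_right {R ι : Type*} [CommRing R] {n : ℕ} (s : Finset ι)
    (x : Equiv.Perm (Fin n) → R) (y : ι → Equiv.Perm (Fin n) → R) (ρ) :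
    conv x (fun σ => ∑ i ∈ s, y i σ) ρ = ∑ i ∈ s, conv x (y i) ρ := by
  simp only [conv, Finset.mul_sum]
  exact Finset.sum_comm

theorem conv_mul_left {R : Type*} [CommRing R] {n : ℕ} (c : R) (x y : Equiv.Perm (Fin n) → R) (ρ) :
    conv (fun σ => c * x σ) y ρ = c * conv x y ρ := by
  simp only [conv, Finset.mul_sum, mul_assoc]

theorem conv_mul_right {R : Type*} [CommRing R] {n : ℕ} (c : R) (x y : Equiv.Perm (Fin n) → R) (ρ) :
    conv x (fun σ => c * y σ) ρ = c * conv x y ρ := by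
  simp only [conv, Finset.mul_sum, mul_left_comm c]

/-- The Eulerian idempotents are orthogonal idempotents of `ℚ[Sₙ]`. -/
theorem conv_eulerianCoeff {n i j : ℕ} (hi : i ∈ Finset.Icc 1 (n + 1))
    (hj : j ∈ Finset.Icc 1 (n + 1)) (ρ : Equiv.Perm (Fin (n + 1))) :
    conv (eulerianCoeff (n + 1) i) (eulerianCoeff (n + 1) j) ρ
      = if i = j then eulerianCoeff (n + 1) i ρ else 0 := by
  rw [← sub_eq_zero]
  -- The identity `ψᵃψᵇ = ψᵃᵇ` is polynomial in `a` and `b`: coefficients of `bʲ` are compared here,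
  -- and those of `aⁱ` for fixed `b` in `key`.
  refine eq_zero_of_sum_pow_smul_eq_zero (K := ℚ) (Finset.Icc 1 (n + 1)) (fun j =>
    conv (eulerianCoeff (n + 1) i) (eulerianCoeff (n + 1) j) ρ
      - if i = j then eulerianCoeff (n + 1) i ρ else 0) (fun b hb => ?_) j hj
  have key := eq_zero_of_sum_pow_smul_eq_zero (K := ℚ) (Finset.Icc 1 (n + 1)) (fun i =>
    ∑ j ∈ Finset.Icc 1 (n + 1), (b : ℚ) ^ j *
      conv (eulerianCoeff (n + 1) i) (eulerianCoeff (n + 1) j) ρ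
      - (b : ℚ) ^ i * eulerianCoeff (n + 1) i ρ) (fun a ha => ?_) i hi
  · simp only [smul_eq_mul, mul_sub, Finset.sum_sub_distrib]
    rw [sub_eq_zero.1 key]
    simp only [mul_ite, mul_zero, Finset.sum_ite_eq, hi, if_true, sub_self]
  · have h := congrArg (fun z : ℤ => (z : ℚ)) (conv_wordCoeff (n + 1) a b ρ)
    have h' : (conv (fun σ => (wordCoeff (n + 1) a σ : ℚ)) (fun σ => (wordCoeff (n + 1) b σ : ℚ)) ρ)
        = (wordCoeff (n + 1) (b * a) ρ : ℚ) := by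
      rw [← h]
      simp [conv]
    simp only [wordCoeff_eq ha, wordCoeff_eq hb, wordCoeff_eq (Nat.mul_pos hb ha), conv_sum_left,
      conv_sum_right, conv_mul_left, conv_mul_right] at h'
    simp only [smul_eq_mul, mul_sub, Finset.sum_sub_distrib, sub_eq_zero]
    simp only [Finset.mul_sum] at h' ⊢
    rw [Finset.sum_comm]
    simp only [mul_left_comm ((a : ℚ) ^ _)]
    rw [h']
    refine Finset.sum_congr rfl fun i _ => ?_
    push_cast
    ring

theorem conv_eulerianSum {n : ℕ} {I J : Finset ℕ} (hI : I ⊆ Finset.Icc 1 (n + 1))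
    (hJ : J ⊆ Finset.Icc 1 (n + 1)) (ρ : Equiv.Perm (Fin (n + 1))) :
    conv (eulerianSum (n + 1) I) (eulerianSum (n + 1) J) ρ = eulerianSum (n + 1) (I ∩ J) ρ := by
  have h : ∀ I, eulerianSum (n + 1) I = fun σ => ∑ i ∈ I, eulerianCoeff (n + 1) i σ :=
    fun I => rfl
  simp only [h, conv_sum_left, conv_sum_right]
  rw [Finset.sum_comm, ← Finset.filter_mem_eq_inter, Finset.sum_filter]
  refine Finset.sum_congr rfl fun i hi => ?_
  refine (Finset.sum_congr rfl fun j hj => conv_eulerianCoeff (hI hi) (hJ hj) ρ).trans ?_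
  simp

/-- The case `m = 1`: the only word in one letter is already sorted, so `ψ¹` is the identity. -/
theorem eulerianSum_Icc (n : ℕ) (σ : Equiv.Perm (Fin (n + 1))) :
    eulerianSum (n + 1) (Finset.Icc 1 (n + 1)) σ = if σ = 1 then 1 else 0 := by
  have := wordCoeff_eq one_pos σ
  rw [wordCoeff_one] at this
  simp only [Nat.cast_one, one_pow, one_mul] at this
  rw [eulerianSum, ← this]
  split_ifs <;> simp

end Counting

/-! ### Splitting a complex and its cohomology by idempotents -/

section Decompose

open scoped DirectSum

variable {k : Type u} {A : Type v} [Field k] [NonUnitalRing A] [Module k A]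
  {I : Type w}
  {W : GradedSub k A} {e : I → ∀ n, Module.End k (Cochain k A n)}

theorem imagePart_apply_self (idem : ∀ i n, ∀ f ∈ W n, e i n (e i n f) = e i n f) {i : I} {n : ℕ}
    {f : Cochain k A n} (hf : f ∈ imagePart W (e i) n) : e i n f = f := by
  obtain ⟨g, hg, rfl⟩ := hf
  exact idem i n g hg

theorem imagePart_apply_of_ne (orth : ∀ i j, i ≠ j → ∀ n, ∀ f ∈ W n, e i n (e j n f) = 0) {i j : I}
    (hij : i ≠ j) {n : ℕ} {f : Cochain k A n} (hf : f ∈ imagePart W (e j) n) : e i n f = 0 := by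
  obtain ⟨g, hg, rfl⟩ := hf
  exact orth i j hij n g hg

variable [IsScalarTower k A A] [SMulCommClass k A A]

theorem mem_cocycles_imagePart
    (comm : ∀ i n, ∀ f ∈ W n, coboundary k A n (e i n f) = e i (n + 1) (coboundary k A n f))
    (i : I) {n : ℕ} {f : Cochain k A n} (hf : f ∈ cocycles W n) :
    e i n f ∈ cocycles (imagePart W (e i)) n :=
  ⟨⟨f, hf.1, rfl⟩, LinearMap.mem_ker.2 (by
    rw [comm i n f hf.1, LinearMap.mem_ker.1 hf.2, map_zero])⟩

theorem mem_coboundaries_imagePart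
    (comm : ∀ i n, ∀ f ∈ W n, coboundary k A n (e i n f) = e i (n + 1) (coboundary k A n f))
    (i : I) : ∀ {n : ℕ} {f : Cochain k A n}, f ∈ coboundaries W n →
      e i n f ∈ coboundaries (imagePart W (e i)) n
  | 0, f, hf => by
    obtain rfl : f = 0 := hf
    rw [map_zero]
    exact Submodule.zero_mem _
  | n + 1, f, hf => by
    obtain ⟨g, hg, rfl⟩ := hf
    exact ⟨e i n g, ⟨g, hg, rfl⟩, comm i n g hg⟩

/-- The projection of the cohomology of a complex to that of a direct summand. -/
def cohomologyProj
    (comm : ∀ i n, ∀ f ∈ W n, coboundary k A n (e i n f) = e i (n + 1) (coboundary k A n f))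
    (i : I) (n : ℕ) : Cohomology W n →ₗ[k] Cohomology (imagePart W (e i)) n :=
  Submodule.mapQ _ _ ((e i n).restrict fun _ hf => mem_cocycles_imagePart comm i hf)
    fun _ hx => mem_coboundaries_imagePart comm i hx

/-- Commuting orthogonal idempotents that add up to the identity decompose a complex. -/
theorem decomposesBy_of_idempotents [DecidableEq I] (isSubcomplex : IsSubcomplex W)
    (mapsTo : ∀ i n, ∀ f ∈ W n, e i n f ∈ W n)
    (comm : ∀ i n, ∀ f ∈ W n, coboundary k A n (e i n f) = e i (n + 1) (coboundary k A n f))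
    (idem : ∀ i n, ∀ f ∈ W n, e i n (e i n f) = e i n f)
    (orth : ∀ i j, i ≠ j → ∀ n, ∀ f ∈ W n, e i n (e j n f) = 0)
    (total : ∀ n, ∃ s : Finset I, ∀ f ∈ W n, ∑ i ∈ s, e i n f = f) : DecomposesBy W e where
  isSubcomplex := isSubcomplex
  mapsTo := mapsTo
  comm := comm
  idem := idem
  orth := orth
  isSubcomplex_part i :=
    { coboundary_mem := by
        rintro n _ ⟨f, hf, rfl⟩
        exact ⟨_, isSubcomplex.coboundary_mem n f hf, (comm i n f hf).symm⟩
      coboundary_coboundary := by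
        rintro n _ ⟨f, hf, rfl⟩
        exact isSubcomplex.coboundary_coboundary n _ (mapsTo i n f hf) }
  independent n i := by
    rw [Submodule.disjoint_def]
    intro f hf hf'
    have h : (⨆ j, ⨆ (_ : j ≠ i), imagePart W (e j) n) ≤ LinearMap.ker (e i n) :=
      iSup_le fun j => iSup_le fun hj g hg => imagePart_apply_of_ne orth hj.symm hg
    rw [← imagePart_apply_self idem hf]
    exact h hf'
  iSup_eq n := by
    refine le_antisymm (iSup_le fun i => ?_) fun f hf => ?_
    · rintro _ ⟨f, hf, rfl⟩
      exact mapsTo i n f hf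
    · obtain ⟨s, hs⟩ := total n
      rw [← hs f hf]
      exact Submodule.sum_mem _ fun i _ =>
        Submodule.mem_iSup_of_mem i (Submodule.mem_map_of_mem hf)
  cohomology := by
    have hle : ∀ i n, imagePart W (e i) n ≤ W n := by
      rintro i n _ ⟨f, hf, rfl⟩
      exact mapsTo i n f hf
    refine ⟨hle, fun n => ⟨?_, ?_⟩⟩
    -- Injectivity: the map induced by `e i` on cohomology recovers the `i`-th component.
    · have hproj : ∀ i, (cohomologyProj comm i n).comp (DirectSum.toModule k I (Cohomology W n)
          fun i => cohomologyMap (hle i) n)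
          = DirectSum.component k I (fun i => Cohomology (imagePart W (e i)) n) i := by
        intro i
        refine DirectSum.linearMap_ext k fun j => ?_
        refine Submodule.linearMap_qext _ (LinearMap.ext fun x => ?_)
        simp only [LinearMap.comp_apply, DirectSum.toModule_lof]
        change (Submodule.Quotient.mk (⟨e i n x, mem_cocycles_imagePart comm i
          (cocycles_mono (hle j) n x.2)⟩ : cocycles (imagePart W (e i)) n) :
            Cohomology (imagePart W (e i)) n) = _
        by_cases hij : j = i
        · subst hij
          rw [DirectSum.component.lof_self]
          exact congrArg _ (Subtype.ext (imagePart_apply_self idem x.2.1))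
        · rw [DirectSum.component.of, dif_neg hij]
          have : e i n x = 0 := imagePart_apply_of_ne orth (Ne.symm hij) x.2.1
          simp only [this]
          rfl
      intro x y hxy
      refine DFinsupp.ext fun i => ?_
      have hx := LinearMap.congr_fun (hproj i) x
      have hy := LinearMap.congr_fun (hproj i) y
      rw [LinearMap.comp_apply] at hx hy
      exact hx.symm.trans ((congrArg _ hxy).trans hy)
    · intro y
      obtain ⟨⟨f, hf⟩, rfl⟩ := Submodule.Quotient.mk_surjective _ y
      obtain ⟨s, hs⟩ := total n
      -- Surjectivity: a cocycle is the sum of its projections, each of them a cocycle of its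
      -- summand.
      refine ⟨∑ i ∈ s, DirectSum.lof k I (fun i => Cohomology (imagePart W (e i)) n) i
        (Submodule.Quotient.mk ⟨e i n f, mem_cocycles_imagePart comm i hf⟩), ?_⟩
      simp only [map_sum, DirectSum.toModule_lof]
      change ∑ i ∈ s, Submodule.mkQ _ (Submodule.inclusion (cocycles_mono (hle i) n) _) = _
      rw [← map_sum]
      refine congrArg _ (Subtype.ext ?_)
      rw [AddSubmonoidClass.coe_finsetSum]
      exact hs f hf.1

end Decompose

/-! ### The group ring acting on cochains, and reduction of rational coefficients -/

section PermOp

variable {k : Type u} {A : Type v} [Field k] [NonUnitalRing A] [Module k A] {n : ℕ}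

variable (A) in
/-- The action on cochains of the element of `k[Sₙ]` with the given coefficients. -/
def permOp (c : Equiv.Perm (Fin n) → k) : Module.End k (Cochain k A n) :=
  ∑ σ, c σ • (MultilinearMap.domDomCongrLinearEquiv k k A A σ⁻¹).toLinearMap

theorem permOp_apply (c : Equiv.Perm (Fin n) → k) (f : Cochain k A n) :
    permOp A c f = ∑ σ, c σ • f.domDomCongr σ⁻¹ := by
  simp only [permOp, LinearMap.sum_apply, LinearMap.smul_apply]
  rfl

/-- With this convention `σ(τf) = (τσ)f`, so the group ring acts with reversed product. -/
theorem permOp_permOp (c d : Equiv.Perm (Fin n) → k) (f : Cochain k A n) :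
    permOp A c (permOp A d f) = permOp A (conv d c) f := by
  ext a
  simp only [permOp_apply, sum_apply, smul_apply, MultilinearMap.domDomCongr_apply, conv,
    Finset.smul_sum, smul_smul, Finset.sum_smul]
  rw [Finset.sum_comm]
  conv_rhs => rw [Finset.sum_comm]
  refine Finset.sum_congr rfl fun τ _ => ?_
  rw [← Equiv.sum_comp (Equiv.mulLeft τ⁻¹)]
  refine Finset.sum_congr rfl fun ρ _ => ?_
  rw [Equiv.coe_mulLeft, mul_comm (c _)]
  congr 2
  funext i
  change a ((τ⁻¹ * ρ)⁻¹ (τ⁻¹ i)) = a (ρ⁻¹ i)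
  rw [mul_inv_rev, inv_inv, Equiv.Perm.mul_apply]
  exact congrArg (fun j => a (ρ⁻¹ j)) (τ.apply_symm_apply i)

theorem permOp_sum {ι : Type*} (s : Finset ι) (c : ι → Equiv.Perm (Fin n) → k)
    (f : Cochain k A n) : permOp A (fun σ => ∑ i ∈ s, c i σ) f = ∑ i ∈ s, permOp A (c i) f := by
  simp only [permOp_apply, Finset.sum_smul]
  exact Finset.sum_comm

theorem permOp_mul (r : k) (c : Equiv.Perm (Fin n) → k)
    (f : Cochain k A n) : permOp A (fun σ => r * c σ) f = r • permOp A c f := by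
  simp only [permOp_apply, mul_smul, Finset.smul_sum]

theorem permOp_one (f : Cochain k A n) : permOp A (fun σ => if σ = 1 then (1 : k) else 0) f = f := by
  simp only [permOp_apply, ite_smul, one_smul, zero_smul, Finset.sum_ite_eq', Finset.mem_univ,
    if_true]
  rfl

theorem permOp_zero (f : Cochain k A n) : permOp A (fun _ => (0 : k)) f = 0 := by
  simp [permOp_apply]

theorem eulerianOp_eq_permOp (J : Finset ℕ) :
    eulerianOp k A n J = permOp A fun σ => ((eulerianSum n J σ : ℚ) : k) := rfl

theorem adamsOp_eq_permOp (m : ℕ) :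
    adamsOp k A n m = permOp A fun σ => ((wordCoeff n m σ : ℤ) : k) := by
  simp only [permOp, adamsOp, wordCoeff_eq_sum, Int.cast_sum, Finset.sum_smul]
  rw [Finset.sum_comm]
  refine Finset.sum_congr rfl fun w _ => ?_
  rw [Finset.sum_eq_single (Tuple.sort w)]
  · rw [if_pos rfl]
  · intro σ _ h
    rw [if_neg h.symm, Int.cast_zero, zero_smul]
  · simp

end PermOp

section Cast

variable {k : Type u} [Field k]

theorem den_ne_zero_of_dvd {a b : ℕ} (h : a ∣ b) (hb : (b : k) ≠ 0) : (a : k) ≠ 0 := by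
  obtain ⟨c, rfl⟩ := h
  rw [Nat.cast_mul] at hb
  exact left_ne_zero_of_mul hb

/-- In characteristic `p` the cast from `ℚ` is additive only on fractions with invertible
denominators, so the denominators are carried along. -/
theorem cast_sum_of_den_ne_zero {ι : Type*} (s : Finset ι) (x : ι → ℚ)
    (h : ∀ i ∈ s, ((x i).den : k) ≠ 0) :
    ((∑ i ∈ s, x i).den : k) ≠ 0 ∧ ((∑ i ∈ s, x i : ℚ) : k) = ∑ i ∈ s, (x i : k) := by
  classical
  induction s using Finset.induction_on with
  | empty => simp
  | insert a s ha ih =>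
    obtain ⟨h1, h2⟩ := ih fun i hi => h i (Finset.mem_insert_of_mem hi)
    have h3 := h a (Finset.mem_insert_self a s)
    rw [Finset.sum_insert ha, Finset.sum_insert ha, Rat.cast_add_of_ne_zero h3 h1, h2]
    refine ⟨den_ne_zero_of_dvd (Rat.add_den_dvd _ _) ?_, rfl⟩
    rw [Nat.cast_mul]
    exact mul_ne_zero h3 h1

theorem cast_conv {n : ℕ} (x y : Equiv.Perm (Fin n) → ℚ) (hx : ∀ σ, ((x σ).den : k) ≠ 0)
    (hy : ∀ σ, ((y σ).den : k) ≠ 0) (ρ) :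
    ((conv x y ρ : ℚ) : k) = conv (fun σ => (x σ : k)) (fun σ => (y σ : k)) ρ := by
  rw [conv, (cast_sum_of_den_ne_zero _ _ fun σ _ => ?_).2]
  · exact Finset.sum_congr rfl fun σ _ => Rat.cast_mul_of_ne_zero (hx _) (hy _)
  · refine den_ne_zero_of_dvd (Rat.mul_den_dvd _ _) ?_
    rw [Nat.cast_mul]
    exact mul_ne_zero (hx _) (hy _)

end Cast

/-! ### Integrality and Adams operations modulo a prime -/

section Arithmetic

variable (p : ℕ)

/-- The power sums of the `p ^ N`-th powers of representatives of the units modulo `p`. -/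
theorem exists_sum_units_pow_eq [Fact p.Prime] (N m : ℕ) : ∃ t : ℤ,
    ∑ u : (ZMod p)ˣ, (((u : ZMod p).val : ℤ) ^ p ^ N) ^ m
      = (if p - 1 ∣ m then (p : ℤ) - 1 else 0) + (p : ℤ) ^ (N + 1) * t := by
  have hp : p.Prime := Fact.out
  have hcard : Fintype.card (ZMod p)ˣ = p - 1 := ZMod.card_units p
  have hval : ∀ u : (ZMod p)ˣ, (((u : ZMod p).val : ℤ) : ZMod p) = u := fun u => by simp
  -- Modulo `p ^ (N + 1)` the `p ^ N`-th power depends only on the residue mod `p`, hence is a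
  -- Teichmüller character to that precision.
  have hcong : ∀ x y : ℤ, (x : ZMod p) = y → (p : ℤ) ^ (N + 1) ∣ x ^ p ^ N - y ^ p ^ N :=
    fun x y hxy => dvd_sub_pow_of_dvd_sub ((ZMod.intCast_eq_intCast_iff_dvd_sub y x p).1 hxy.symm) N
  suffices h : (p : ℤ) ^ (N + 1) ∣ ∑ u : (ZMod p)ˣ, (((u : ZMod p).val : ℤ) ^ p ^ N) ^ m
      - (if p - 1 ∣ m then (p : ℤ) - 1 else 0) by
    obtain ⟨t, ht⟩ := h
    exact ⟨t, by rw [← ht]; ring⟩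
  split_ifs with hm
  · obtain ⟨r, rfl⟩ := hm
    have h1 : ((p : ℤ) - 1) = ∑ u : (ZMod p)ˣ, (1 : ℤ) := by
      rw [Finset.sum_const, Finset.card_univ, hcard, nsmul_eq_mul, mul_one,
        Nat.cast_sub hp.one_le, Nat.cast_one]
    rw [h1, ← Finset.sum_sub_distrib]
    refine Finset.dvd_sum fun u _ => ?_
    have h2 := hcong (((u : ZMod p).val : ℤ) ^ ((p - 1) * r)) 1 (by
      rw [Int.cast_pow, hval, pow_mul, ZMod.pow_card_sub_one_eq_one u.ne_zero, one_pow,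
        Int.cast_one])
    rwa [one_pow, ← pow_mul, mul_comm, pow_mul] at h2
  · rw [sub_zero]
    obtain ⟨g, hg⟩ := IsCyclic.exists_generator (α := (ZMod p)ˣ)
    have hgm : (g : ZMod p) ^ m ≠ 1 := by
      intro h
      apply hm
      rw [← hcard, ← Nat.card_eq_fintype_card, ← orderOf_eq_card_of_forall_mem_zpowers hg]
      exact orderOf_dvd_of_pow_eq_one (Units.ext (by simpa using h))
    -- Translation by the generator `g` multiplies the sum by the value of the character at `g`.
    -- That value minus one is prime to `p`, so the sum vanishes modulo `p ^ (N + 1)`.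
    have hco : IsCoprime ((p : ℤ) ^ (N + 1)) ((((g : ZMod p).val : ℤ) ^ p ^ N) ^ m - 1) := by
      refine IsCoprime.pow_left ((Nat.prime_iff_prime_int.1 hp).coprime_iff_not_dvd.2 ?_)
      rw [← ZMod.intCast_zmod_eq_zero_iff_dvd]
      intro h
      apply hgm
      rw [Int.cast_sub, Int.cast_pow, Int.cast_pow, hval, ZMod.pow_card_pow, Int.cast_one,
        sub_eq_zero] at h
      exact h
    refine hco.dvd_of_dvd_mul_left ?_
    rw [sub_mul, one_mul, Finset.mul_sum]
    rw [← Equiv.sum_comp (Equiv.mulLeft g) fun u : (ZMod p)ˣ =>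
      (((u : ZMod p).val : ℤ) ^ p ^ N) ^ m, ← Finset.sum_sub_distrib]
    refine Finset.dvd_sum fun u _ => ?_
    rw [← mul_pow, ← mul_pow]
    refine (hcong _ _ ?_).trans (sub_dvd_pow_sub_pow _ _ m)
    rw [Int.cast_mul, hval, hval, hval]
    rfl

open Polynomial in
theorem exists_factorial_mul_eulerianCoeff (n j : ℕ) (σ : Equiv.Perm (Fin n)) :
    ∃ z : ℤ, (n.factorial : ℚ) * eulerianCoeff n j σ = z := by
  have h : ∏ l ∈ Finset.range n, (X + C ((n : ℚ) - 1 - descents σ - l))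
      = (∏ l ∈ Finset.range n, (X + C ((n : ℤ) - 1 - descents σ - l))).map (Int.castRingHom ℚ) := by
    simp [Polynomial.map_prod]
  refine ⟨Equiv.Perm.sign σ *
    (∏ l ∈ Finset.range n, (X + C ((n : ℤ) - 1 - descents σ - l))).coeff j, ?_⟩
  rw [eulerianCoeff, binomPoly, h, coeff_C_mul, coeff_map]
  have := Nat.cast_ne_zero (R := ℚ).2 n.factorial_ne_zero
  push_cast
  field_simp
  simp

variable {p} (k : Type*) [Field k] [CharP k p]

theorem cast_of_mul_eq {q : ℚ} {u : ℕ} (hu : ¬ p ∣ u) {w : ℤ} (h : (u : ℚ) * q = w) :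
    ¬ p ∣ q.den ∧ (u : k) * (q : k) = w := by
  have hden : q.den ∣ u := by
    have hu0 : (u : ℚ) ≠ 0 := by
      rintro h0
      exact hu (by rw [Nat.cast_eq_zero.1 h0]; exact dvd_zero p)
    have : q = Rat.divInt w u := by
      rw [Rat.divInt_eq_div, ← h]
      push_cast
      field_simp
    rw [this]
    exact_mod_cast Rat.den_dvd w u
  refine ⟨fun h' => hu (h'.trans hden), ?_⟩
  have h1 : ((q.den : ℕ) : k) ≠ 0 := fun h' =>
    hu (((CharP.cast_eq_zero_iff k p _).1 h').trans hden)
  have h2 := Rat.cast_mul_of_ne_zero (α := k) (p := (u : ℚ)) (q := q) (by simp) h1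
  rw [h, Rat.cast_natCast, Rat.cast_intCast] at h2
  exact h2.symm

theorem dvd_sub_add_iff {p i j : ℕ} (hi : i ≤ p - 1) :
    p - 1 ∣ p - 1 - i + j ↔ j ≡ i [MOD p - 1] := by
  rw [← Nat.modEq_zero_iff_dvd]
  constructor
  · intro h
    have := h.add_right i
    rw [show p - 1 - i + j + i = (p - 1) + j by omega, zero_add] at this
    simpa [Nat.ModEq] using this
  · intro h
    have := h.add_left (p - 1 - i)
    rw [show p - 1 - i + i = p - 1 by omega] at this
    simpa [Nat.ModEq] using this

/-- The sums of Eulerian idempotents over residue classes are `p`-integral, and modulo `p` they are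
combinations of Adams operations. -/
theorem eulerianSum_residueClass [Fact p.Prime] {n N i : ℕ} (hN : (n + 1).factorial ≤ N) (hi : i ≤ p - 1)
    (σ : Equiv.Perm (Fin (n + 1))) :
    ¬ p ∣ (eulerianSum (n + 1) (residueClass p (n + 1) i) σ).den ∧
    ((eulerianSum (n + 1) (residueClass p (n + 1) i) σ : ℚ) : k)
      = ∑ u : (ZMod p)ˣ, -(((u : ZMod p).val : k) ^ p ^ N) ^ (p - 1 - i) *
        (wordCoeff (n + 1) ((u : ZMod p).val ^ p ^ N) σ : k) := by
  have hp : p.Prime := Fact.out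
  obtain ⟨v, D, hD, hfac⟩ := Nat.exists_eq_pow_mul_and_not_dvd (n + 1).factorial_ne_zero p
    hp.ne_one
  -- Here `v` is the exponent of `p` in `(n + 1)!`. The factorial itself is a crude bound for it,
  -- through `v < p ^ v ≤ (n + 1)!`.
  have hv : v ≤ N := by
    refine le_trans (Nat.lt_pow_self hp.one_lt).le (le_trans ?_ hN)
    exact Nat.le_of_dvd (n + 1).factorial_pos ⟨D, hfac⟩
  choose z hz using fun j => exists_factorial_mul_eulerianCoeff (n + 1) j σ
  choose t ht using fun m => exists_sum_units_pow_eq p N m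
  have hint : ∀ j, (D : ℚ) * (p : ℚ) ^ N * eulerianCoeff (n + 1) j σ = (p : ℚ) ^ (N - v) * z j := by
    intro j
    rw [← hz, hfac, Nat.cast_mul, Nat.cast_pow]
    nth_rw 1 [← Nat.sub_add_cancel hv]
    ring
  have hpos : ∀ u : (ZMod p)ˣ, 0 < (u : ZMod p).val ^ p ^ N := fun u =>
    Nat.pow_pos (Nat.pos_of_ne_zero fun h => u.ne_zero ((ZMod.val_eq_zero _).1 h))
  -- A discrete Fourier sum: the exponent `p - 1 - i` stands for `-i`, and `ψᵐ` contributes `mʲ`, so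
  -- only `j ≡ i` survives up to multiples of `p ^ (N + 1)`.
  set Z : ℤ := ∑ u : (ZMod p)ˣ, (((u : ZMod p).val : ℤ) ^ p ^ N) ^ (p - 1 - i) *
        wordCoeff (n + 1) ((u : ZMod p).val ^ p ^ N) σ with hZ
  have hZ' : (Z : ℚ) = ∑ j ∈ Finset.Icc 1 (n + 1), eulerianCoeff (n + 1) j σ *
      ((if p - 1 ∣ p - 1 - i + j then (p : ℚ) - 1 else 0)
        + (p : ℚ) ^ (N + 1) * t (p - 1 - i + j)) := by
    have h1 : ∀ m, ((if p - 1 ∣ m then (p : ℚ) - 1 else 0) + (p : ℚ) ^ (N + 1) * t m)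
        = ∑ u : (ZMod p)ˣ, (((u : ZMod p).val : ℚ) ^ p ^ N) ^ m := by
      intro m
      have := congrArg (fun x : ℤ => (x : ℚ)) (ht m)
      push_cast at this
      rw [this]
    simp only [h1, hZ, Finset.mul_sum]
    push_cast
    simp only [wordCoeff_eq (hpos _), Finset.mul_sum]
    rw [Finset.sum_comm]
    refine Finset.sum_congr rfl fun j _ => Finset.sum_congr rfl fun u _ => ?_
    push_cast
    rw [pow_add]
    ring
  -- The factor `D` clears the denominators prime to `p`. Of `p ^ (N + 1)` in the error, `p ^ N`
  -- clears the `p`-part and one factor `p` is left.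
  have hkey : ((D * (p - 1) : ℕ) : ℚ) * eulerianSum (n + 1) (residueClass p (n + 1) i) σ
      = ((D * Z - p * ∑ j ∈ Finset.Icc 1 (n + 1), (p : ℤ) ^ (N - v) * z j * t (p - 1 - i + j) : ℤ)
        : ℚ) := by
    push_cast
    rw [hZ', Nat.cast_sub hp.one_le, Nat.cast_one, eulerianSum, residueClass, Finset.sum_filter]
    simp only [← hint, Finset.mul_sum]
    rw [← Finset.sum_sub_distrib]
    refine Finset.sum_congr rfl fun j _ => ?_
    simp only [dvd_sub_add_iff hi]
    split_ifs <;> ring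
  have hu : ¬ p ∣ D * (p - 1) := by
    rw [hp.dvd_mul]
    rintro (h | h)
    · exact hD h
    · exact absurd (Nat.le_of_dvd (Nat.sub_pos_of_lt hp.one_lt) h) (by have := hp.pos; omega)
  obtain ⟨h1, h2⟩ := cast_of_mul_eq k hu hkey
  refine ⟨h1, ?_⟩
  have hD' : (D : k) ≠ 0 := fun h => hD ((CharP.cast_eq_zero_iff k p _).1 h)
  -- In `k` the error vanishes, `p - 1` becomes `-1`, and the unit `D` cancels.
  rw [Nat.cast_mul, Nat.cast_sub hp.one_le, CharP.cast_eq_zero k p, Int.cast_sub, Int.cast_mul,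
    Int.cast_mul, Int.cast_natCast, Int.cast_natCast, CharP.cast_eq_zero k p, zero_mul, sub_zero,
    mul_assoc] at h2
  have h3 := mul_left_cancel₀ hD' h2
  rw [Nat.cast_one, zero_sub, neg_one_mul, neg_eq_iff_eq_neg] at h3
  rw [h3, hZ]
  push_cast
  rw [← Finset.sum_neg_distrib]
  exact Finset.sum_congr rfl fun u _ => by rw [neg_mul]

end Arithmetic

/-! ### Assembling the decompositions -/

section Hodge

variable {k : Type u} {A : Type v} [Field k] [NonUnitalCommRing A] [Module k A]

theorem eulerianSum_filter {n : ℕ} (J : Finset ℕ) (σ : Equiv.Perm (Fin n)) :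
    eulerianSum n (J.filter (· ≤ n)) σ = eulerianSum n J σ := by
  refine Finset.sum_subset (Finset.filter_subset _ _) fun j hj hj' => eulerianCoeff_of_lt ?_ σ
  simpa [hj] using hj'

theorem eulerianOp_filter (n : ℕ) (J : Finset ℕ) :
    eulerianOp k A n (J.filter (· ≤ n)) = eulerianOp k A n J := by
  simp only [eulerianOp_eq_permOp, eulerianSum_filter]

theorem eulerianOp_empty (n : ℕ) (f : Cochain k A n) : eulerianOp k A n ∅ f = 0 := by
  rw [eulerianOp_eq_permOp, ← permOp_zero (A := A) f]
  simp [eulerianSum]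

theorem eulerianOp_eulerianOp {n : ℕ} {I J : Finset ℕ} (hI : I ⊆ Finset.Icc 1 (n + 1))
    (hJ : J ⊆ Finset.Icc 1 (n + 1)) (hI' : ∀ σ, ((eulerianSum (n + 1) I σ).den : k) ≠ 0)
    (hJ' : ∀ σ, ((eulerianSum (n + 1) J σ).den : k) ≠ 0) (f : Cochain k A (n + 1)) :
    eulerianOp k A (n + 1) I (eulerianOp k A (n + 1) J f) = eulerianOp k A (n + 1) (I ∩ J) f := by
  simp only [eulerianOp_eq_permOp, permOp_permOp, Finset.inter_comm I, ← conv_eulerianSum hJ hI,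
    cast_conv _ _ hJ' hI']

/-- Indices above the degree contribute zero. The free upper bound `N` lets neighbouring degrees
share one range of summation. -/
theorem adamsOp_eq_sum [CharZero k] {n m N : ℕ} (hm : 0 < m) (hN : n + 1 ≤ N) (f : Cochain k A (n + 1)) :
    adamsOp k A (n + 1) m f
      = ∑ j ∈ Finset.Icc 1 N, (m : k) ^ j • eulerianOp k A (n + 1) {j} f := by
  have h : ∀ σ : Equiv.Perm (Fin (n + 1)), (wordCoeff (n + 1) m σ : k)
      = ∑ j ∈ Finset.Icc 1 N, (m : k) ^ j * ((eulerianSum (n + 1) {j} σ : ℚ) : k) := by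
    intro σ
    have h1 := wordCoeff_eq hm σ
    rw [Finset.sum_subset (Finset.Icc_subset_Icc_right hN) fun j hj hj' => by
      rw [eulerianCoeff_of_lt, mul_zero]
      simp only [Finset.mem_Icc] at hj hj'
      omega] at h1
    have h2 := congrArg (fun q : ℚ => (q : k)) h1
    push_cast at h2
    simpa [eulerianSum] using h2
  rw [adamsOp_eq_permOp]
  simp only [h, permOp_sum, permOp_mul, eulerianOp_eq_permOp]

theorem eulerianOp_residueClass {p : ℕ} [Fact p.Prime] [CharP k p] {n N i : ℕ} (hN : (n + 1).factorial ≤ N) (hi : i ≤ p - 1)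
    (f : Cochain k A (n + 1)) :
    eulerianOp k A (n + 1) (residueClass p (n + 1) i) f
      = ∑ u : (ZMod p)ˣ, -(((u : ZMod p).val : k) ^ p ^ N) ^ (p - 1 - i) •
        adamsOp k A (n + 1) ((u : ZMod p).val ^ p ^ N) f := by
  rw [eulerianOp_eq_permOp]
  simp only [(eulerianSum_residueClass k hN hi _).2, permOp_sum, permOp_mul, adamsOp_eq_permOp]

variable {S : Type w} [CommSemigroup S] (ι : S →ₙ* A)

theorem permOp_mem_coherent {n : ℕ} (c : Equiv.Perm (Fin n) → k) {f : Cochain k A n}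
    (hf : f ∈ coherent ι n) : permOp A c f ∈ coherent ι n := by
  rw [permOp_apply]
  exact Submodule.sum_mem _ fun σ _ =>
    Submodule.smul_mem _ _ (domDomCongr_mem_coherent ι n hf σ⁻¹)

theorem imagePart_hodgeOp_eq_bot {n i : ℕ} (h : n < i) :
    imagePart (coherent ι) (hodgeOp k A i) n = ⊥ := by
  rw [imagePart, hodgeOp, ← eulerianOp_filter, Finset.filter_singleton, if_neg h.not_ge]
  refine (Submodule.eq_bot_iff _).2 ?_
  rintro _ ⟨f, _, rfl⟩
  exact eulerianOp_empty n f

variable [IsScalarTower k A A] [SMulCommClass k A A]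

/-- Sums of Eulerian idempotents over the parts of a partition of the indices decompose the coherent
complex, if they are defined over `k` and commute with the coboundary. -/
theorem decomposesBy_eulerianOp {I : Type*} [DecidableEq I] (J : I → ℕ → Finset ℕ)
    (subset : ∀ i n, J i n ⊆ Finset.Icc 1 n)
    (disjoint : ∀ i j, i ≠ j → ∀ n, Disjoint (J i n) (J j n))
    (cover : ∀ n, ∃ s : Finset I, s.biUnion (fun i => J i n) = Finset.Icc 1 n)
    (den : ∀ i n σ, ((eulerianSum n (J i n) σ).den : k) ≠ 0)
    (comm : ∀ i n (f : Cochain k A (n + 1)),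
      coboundary k A (n + 1) (eulerianOp k A (n + 1) (J i (n + 1)) f)
        = eulerianOp k A (n + 2) (J i (n + 2)) (coboundary k A (n + 1) f)) :
    DecomposesBy (coherent ι) (fun i n => eulerianOp k A n (J i n)) := by
  have hzero : ∀ f ∈ coherent (k := k) ι 0, f = 0 := fun f hf => hf
  refine decomposesBy_of_idempotents ⟨fun n f hf => coboundary_mem_coherent ι n hf,
    fun n f _ => coboundary_coboundary f⟩ (fun i n f hf => permOp_mem_coherent ι _ hf) ?_ ?_ ?_ ?_
  · rintro i (_ | n) f hf
    · rw [hzero f hf]; simp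
    · exact comm i n f
  · rintro i (_ | n) f hf
    · rw [hzero f hf]; simp
    · rw [eulerianOp_eulerianOp (subset i _) (subset i _) (den i _) (den i _), Finset.inter_self]
  · rintro i j hij (_ | n) f hf
    · rw [hzero f hf]; simp
    · rw [eulerianOp_eulerianOp (subset i _) (subset j _) (den i _) (den j _),
        Finset.disjoint_iff_inter_eq_empty.1 (disjoint i j hij _), eulerianOp_empty]
  · rintro (_ | n)
    -- In degree `0` the index set is empty and the operators vanish; they add up to the identity
    -- there only because `CC⁰ = 0`.
    · exact ⟨∅, fun f hf => by rw [hzero f hf]; simp⟩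
    · obtain ⟨s, hs⟩ := cover (n + 1)
      refine ⟨s, fun f _ => ?_⟩
      simp only [eulerianOp_eq_permOp]
      rw [← permOp_sum]
      conv_rhs => rw [← permOp_one f]
      congr 2
      funext σ
      rw [← (cast_sum_of_den_ne_zero s (fun i => eulerianSum (n + 1) (J i (n + 1)) σ)
        fun i _ => den i _ σ).2]
      have : ∑ i ∈ s, eulerianSum (n + 1) (J i (n + 1)) σ = if σ = 1 then 1 else 0 := by
        rw [← eulerianSum_Icc, ← hs]
        exact (Finset.sum_biUnion fun i _ j _ hij => disjoint i j hij _).symm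
      rw [this]
      split_ifs <;> simp

section CharZero

variable [CharZero k]

theorem coboundary_eulerianOp_singleton {n i : ℕ} (hi : 0 < i) (f : Cochain k A (n + 1)) :
    coboundary k A (n + 1) (eulerianOp k A (n + 1) {i} f)
      = eulerianOp k A (n + 2) {i} (coboundary k A (n + 1) f) := by
  rw [← sub_eq_zero]
  -- The range contains `i` and every index relevant in degrees `n + 1` and `n + 2`.
  refine eq_zero_of_sum_pow_smul_eq_zero (K := k) (Finset.Icc 1 (max i (n + 2))) (fun i =>
    coboundary k A (n + 1) (eulerianOp k A (n + 1) {i} f)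
      - eulerianOp k A (n + 2) {i} (coboundary k A (n + 1) f)) (fun m hm => ?_) i
      (by simp; omega)
  obtain ⟨q, rfl⟩ := Nat.exists_eq_succ_of_ne_zero hm.ne'
  have := coboundary_adamsOp (q := q) f
  rw [adamsOp_eq_sum hm (N := max i (n + 2)) (by omega),
    adamsOp_eq_sum hm (N := max i (n + 2)) (by omega)] at this
  simp only [smul_sub, Finset.sum_sub_distrib]
  rw [← this]
  simp

theorem decomposesBy_hodgeOp : DecomposesBy (coherent ι) (fun i : ℕ+ => hodgeOp k A i) := by
  have h : (fun i : ℕ+ => hodgeOp k A i)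
      = fun (i : ℕ+) n => eulerianOp k A n (({(i : ℕ)} : Finset ℕ).filter (· ≤ n)) := by
    funext i n
    rw [eulerianOp_filter, hodgeOp]
  rw [h]
  refine decomposesBy_eulerianOp ι (fun (i : ℕ+) n => ({(i : ℕ)} : Finset ℕ).filter (· ≤ n))
    ?_ ?_ ?_ ?_ ?_
  · intro i n j hj
    simp only [Finset.mem_filter, Finset.mem_singleton] at hj
    have := i.pos
    simp only [Finset.mem_Icc]
    omega
  · intro i j hij n
    refine Finset.disjoint_filter_filter ?_
    simpa using hij
  · intro n
    -- Although there are infinitely many summands, only the indices `1, …, n` matter in degree `n`.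
    refine ⟨(Finset.range n).image Nat.succPNat, ?_⟩
    ext j
    simp only [Finset.mem_biUnion, Finset.mem_image, Finset.mem_range, Finset.mem_filter,
      Finset.mem_singleton, Finset.mem_Icc]
    constructor
    · rintro ⟨_, ⟨a, ha, rfl⟩, rfl, h⟩
      simp
      omega
    · rintro ⟨h1, h2⟩
      exact ⟨_, ⟨j - 1, by omega, rfl⟩, by simp; omega, h2⟩
  · intro i n σ
    exact Nat.cast_ne_zero.2 (Rat.den_ne_zero _)
  · intro i n f
    rw [eulerianOp_filter, eulerianOp_filter, coboundary_eulerianOp_singleton i.pos]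

end CharZero

section CharP

variable {p : ℕ} [Fact p.Prime] [CharP k p]

theorem den_eulerianSum_residueClass {n i : ℕ} (hi : i ≤ p - 1) (σ : Equiv.Perm (Fin n)) :
    ¬ p ∣ (eulerianSum n (residueClass p n i) σ).den := by
  cases n with
  | zero =>
    have : residueClass p 0 i = ∅ := by simp [residueClass]
    simpa [this, eulerianSum] using (Fact.out : p.Prime).one_lt.ne'
  | succ n => exact (eulerianSum_residueClass (ZMod p) le_rfl hi σ).1

theorem coboundary_eulerianOp_residueClass {n i : ℕ} (hi : i ≤ p - 1) (f : Cochain k A (n + 1)) :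
    coboundary k A (n + 1) (eulerianOp k A (n + 1) (residueClass p (n + 1) i) f)
      = eulerianOp k A (n + 2) (residueClass p (n + 2) i) (coboundary k A (n + 1) f) := by
  -- The same `N` in both degrees makes the two sides the same combination of the same Adams
  -- operations, which commute with `δ`.
  rw [eulerianOp_residueClass (N := (n + 2).factorial) (Nat.factorial_le (by omega)) hi,
    eulerianOp_residueClass (N := (n + 2).factorial) le_rfl hi]
  simp only [map_sum, map_smul]
  refine Finset.sum_congr rfl fun u _ => ?_
  have hpos : (u : ZMod p).val ^ p ^ (n + 2).factorial ≠ 0 :=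
    pow_ne_zero _ fun h => u.ne_zero ((ZMod.val_eq_zero _).1 h)
  obtain ⟨q, hq⟩ := Nat.exists_eq_succ_of_ne_zero hpos
  rw [hq, coboundary_adamsOp]

theorem decomposesBy_hodgeOpMod :
    DecomposesBy (coherent ι) (fun i : Fin (p - 1) => hodgeOpMod k p A (i + 1)) := by
  have hp : p.Prime := Fact.out
  refine decomposesBy_eulerianOp ι (fun (i : Fin (p - 1)) n => residueClass p n (i + 1))
    ?_ ?_ ?_ ?_ ?_
  · exact fun i n => Finset.filter_subset _ _
  · intro i j hij n
    rw [Finset.disjoint_left]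
    intro l hl hl'
    have h1 := (Finset.mem_filter.1 hl).2
    have h2 := (Finset.mem_filter.1 hl').2
    exact hij (Fin.ext (Nat.ModEq.eq_of_lt_of_lt
      (Nat.ModEq.add_right_cancel' 1 (h1.symm.trans h2)) i.2 j.2))
  · intro n
    refine ⟨Finset.univ, ?_⟩
    ext j
    simp only [Finset.mem_biUnion, Finset.mem_univ, true_and]
    constructor
    · rintro ⟨i, hi⟩
      exact (Finset.mem_filter.1 hi).1
    · intro hj
      have hj1 := (Finset.mem_Icc.1 hj).1
      -- The index `i : Fin (p - 1)` stands for the residue `i + 1`, hence the shift by one.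
      refine ⟨⟨(j - 1) % (p - 1), Nat.mod_lt _ (Nat.sub_pos_of_lt hp.one_lt)⟩,
        Finset.mem_filter.2 ⟨hj, ?_⟩⟩
      have := (Nat.mod_modEq (j - 1) (p - 1)).symm.add_right 1
      rwa [Nat.sub_add_cancel hj1] at this
  · intro i n σ h
    exact den_eulerianSum_residueClass i.2 σ ((CharP.cast_eq_zero_iff k p _).1 h)
  · exact fun i n f => coboundary_eulerianOp_residueClass i.2 f

end CharP

end Hodge

end CoherentHodge

end

open CoherentHodge in
theorem theorem2 (k : Type*) [Field k] (S : Type*) [CommSemigroup S] :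
    -- characteristic zero: full decomposition, for `k[S]` and for `k[S] / k z` if `S` has a zero `z`
    (CharZero k →
      (DecomposesBy (coherent (MonoidAlgebra.ofMagma k S))
          (fun i : ℕ+ => hodgeOp k (MonoidAlgebra k S) i) ∧
        ∀ (n : ℕ) (i : ℕ+), n < i →
          imagePart (coherent (MonoidAlgebra.ofMagma k S))
            (hodgeOp k (MonoidAlgebra k S) i) n = ⊥) ∧
      (∀ z : S, (∀ s, z * s = z) →
        DecomposesBy (coherent (toContracted k z))
          (fun i : ℕ+ => hodgeOp k (ContractedAlgebra k z) i) ∧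
        ∀ (n : ℕ) (i : ℕ+), n < i →
          imagePart (coherent (toContracted k z))
            (hodgeOp k (ContractedAlgebra k z) i) n = ⊥)) ∧
    -- characteristic `p`: `p - 1` summands, indexed by the residues `1, …, p - 1` modulo `p - 1`
    (∀ p : ℕ, p.Prime → CharP k p →
      -- the idempotents have `p`-integral coefficients, so that they make sense over `k`
      (∀ (i : Fin (p - 1)) (n : ℕ) (σ : Equiv.Perm (Fin n)),
        ¬ p ∣ (eulerianSum n (residueClass p n (i + 1)) σ).den) ∧
      DecomposesBy (coherent (MonoidAlgebra.ofMagma k S))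
        (fun i : Fin (p - 1) => hodgeOpMod k p (MonoidAlgebra k S) (i + 1)) ∧
      (∀ z : S, (∀ s, z * s = z) →
        DecomposesBy (coherent (toContracted k z))
          (fun i : Fin (p - 1) => hodgeOpMod k p (ContractedAlgebra k z) (i + 1)))) := by
  refine ⟨fun _ => ⟨⟨decomposesBy_hodgeOp _, fun n i h => imagePart_hodgeOp_eq_bot _ h⟩,
    fun z _ => ⟨decomposesBy_hodgeOp _, fun n i h => imagePart_hodgeOp_eq_bot _ h⟩⟩,
    fun p hp _ => ?_⟩
  have : Fact p.Prime := ⟨hp⟩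
  exact ⟨fun i n σ => den_eulerianSum_residueClass i.2 σ, decomposesBy_hodgeOpMod _,
    fun z _ => decomposesBy_hodgeOpMod _⟩
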